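/- Let $\alpha=(\sqrt5-1)/2$ be the golden ratio, i.e. the positive root of $\alpha^2+\alpha=1$, let $\mathbb T=\mathbb R/\mathbb Z$ with normalized Lebesgue measure $\lambda$, and let $Tx=x+\alpha$ on $\mathbb T$. For a $C^2$ map $\varphi:\mathbb T\to SU(2)$ and $n\ge 1$ put $\varphi^{(n)}(x)=\varphi(x)\varphi(Tx)\cdots\varphi(T^{n-1}x)$, let $D$ denote the derivative with respect to $x$, and for $A=[a_{ij}]\in\mathfrak{su}(2)$ let $\|A\|=\bigl(\tfrac12\sum_{i,j=1}^2|a_{ij}|^2\bigr)^{1/2}$. Then the maps $\frac1n D\varphi^{(n)}\,(\varphi^{(n)})^{-1}$ converge, in $L^2(\mathbb T,\mathfrak{su}(2))$ and $\lambda$-almost everywhere, to some $\psi\in L^2(\mathbb T,\mathfrak{su}(2))$ whose norm $\|\psi(x)\|$ is $\lambda$-a.e. equal to a constant $d(\varphi)$, the degree of $\varphi$, and $$d(\varphi)\in 2\pi\mathbb N_0=\{2\pi k: k=0,1,2,\dots\}.$$ -/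

import Mathlib

open MeasureTheory Filter Topology

noncomputable section

namespace SU2Cocycle

/-- The group `SU(2)`. -/
abbrev SU2 : Type := Matrix.specialUnitaryGroup (Fin 2) ℂ

/-- The Lie algebra `𝔰𝔲(2)` of traceless skew-Hermitian matrices. -/
def su2 : Set (Matrix (Fin 2) (Fin 2) ℂ) :=
  {A | A.conjTranspose = -A ∧ A.trace = 0}

/-- The normalized Hilbert-Schmidt norm `‖A‖ = √((1/2) ∑ |aᵢⱼ|²)` on `2 × 2` matrices. -/
def hsNorm (A : Matrix (Fin 2) (Fin 2) ℂ) : ℝ :=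
  Real.sqrt ((1 / 2 : ℝ) * ∑ i, ∑ j, ‖A i j‖ ^ 2)

/-- `f : ℝ/ℤ → SU(2)` is of class `C^k`: the entries of its `1`-periodic lift to `ℝ` are `C^k`. -/
def IsClassC (k : ℕ) (f : UnitAddCircle → SU2) : Prop :=
  ∀ i j : Fin 2, ContDiff ℝ k (fun t : ℝ => (f (t : UnitAddCircle)).1 i j)

/-- The entrywise derivative `Df(x) = d/dt f(x + t)` at `t = 0`, for `f` defined on the circle. -/
def D (f : UnitAddCircle → SU2) (x : UnitAddCircle) : Matrix (Fin 2) (Fin 2) ℂ :=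
  Matrix.of fun i j => deriv (fun t : ℝ => (f (x + (t : UnitAddCircle))).1 i j) 0

/-- The iterates `φ⁽ⁿ⁾(x) = φ(x) φ(Tx) ⋯ φ(Tⁿ⁻¹x)`, for `n ≥ 0`, of the cocycle generated by `φ`
over the rotation `Tx = x + α`. -/
def iter (α : UnitAddCircle) (φ : UnitAddCircle → SU2) : ℕ → UnitAddCircle → SU2
  | 0, _ => 1
  | n + 1, x => iter α φ n x * φ (x + n • α)

/-- The averaged logarithmic derivative `(1/n) Dφ⁽ⁿ⁾(x) (φ⁽ⁿ⁾(x))⁻¹`. -/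
def logDerivAvg (α : UnitAddCircle) (φ : UnitAddCircle → SU2) (n : ℕ) (x : UnitAddCircle) :
    Matrix (Fin 2) (Fin 2) ℂ :=
  (n : ℝ)⁻¹ • (D (iter α φ n) x * ((iter α φ n x)⁻¹ : SU2).1)

/-- `d` is the degree `d(φ)` of the cocycle `φ` over the rotation by `α`: the sequence
`(1/n) Dφ⁽ⁿ⁾ (φ⁽ⁿ⁾)⁻¹` converges in `L²` and almost everywhere to some `ψ ∈ L²(ℝ/ℤ, 𝔰𝔲(2))`,
and `‖ψ‖ = d` almost everywhere. -/
def IsDegree (α : UnitAddCircle) (φ : UnitAddCircle → SU2) (d : ℝ) : Prop :=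
  ∃ ψ : UnitAddCircle → Matrix (Fin 2) (Fin 2) ℂ,
    (∀ x, ψ x ∈ su2) ∧
    (∀ i j, MemLp (fun x => ψ x i j) 2 (volume : Measure UnitAddCircle)) ∧
    Tendsto (fun n : ℕ => ∫⁻ x : UnitAddCircle,
      ENNReal.ofReal (hsNorm (logDerivAvg α φ n x - ψ x) ^ 2)) atTop (𝓝 0) ∧
    (∀ᵐ x : UnitAddCircle, Tendsto (fun n : ℕ => logDerivAvg α φ n x) atTop (𝓝 (ψ x))) ∧
    (∀ᵐ x : UnitAddCircle, hsNorm (ψ x) = d)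

/-- A cocycle has at most one degree. -/
theorem IsDegree.unique {α : UnitAddCircle} {φ : UnitAddCircle → SU2} {d d' : ℝ}
    (h : IsDegree α φ d) (h' : IsDegree α φ d') : d = d' := by
  obtain ⟨ψ, -, -, -, h1, h2⟩ := h
  obtain ⟨ψ', -, -, -, h1', h2'⟩ := h'
  obtain ⟨x, a, b, a', b'⟩ := (h1.and (h2.and (h1'.and h2'))).exists
  rw [← b, ← b', tendsto_nhds_unique a a']

end SU2Cocycle

end

noncomputable section

namespace SU2Cocycle

open scoped Quaternion ENNReal NNReal

/-! ### Rotations generated by an imaginary quaternion -/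

/-! Identify `SU(2)` with the unit quaternions. By the product rule the logarithmic derivative of
the `n`-th iterate is the sum over `k < n` of `U^k f`, where `f = Q' Q⁻¹` and `U g = Q (g ∘ T) Q⁻¹`
(`transfer`, `hasDerivAt_quatIter`). Since `Q` is unit valued and `T` preserves measure, `U` is an
isometry of `L²`. The mean ergodic theorem gives an `L²` limit `ψ` with `Uψ = ψ`, and Hopf's maximal
inequality upgrades this to almost everywhere convergence. Invariance makes `‖ψ‖` a `T`-invariant
function, so it is a constant `d` by ergodicity.

For integrality suppose `d > 0`. Take consecutive Fibonacci denominators `m`, `m'`, with small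
displacements `θ ≡ mα` and `θ' ≡ m'α` mod 1. Write `a`, `b` for the iterates of orders `m`, `m'` at
`x`. As the logarithmic derivative of the `m'`-th iterate is about `m'ψ`, moving it from `x` to `x +
θ` multiplies it on the left by about `exp(m'θ ψ)`; similarly for `m` and `θ'`
(`enorm_quatIter_sub_rot_le`). Computing the iterate of order `m + m'` in its two factorizations
then gives `exp(m'θ ψ(x)) a b ≈ exp(mθ' ψ(x)) b a`.

Invariance also says that `a` conjugates `ψ(x + θ)` to `ψ(x)`. These two are close on average, so
`a` and likewise `b` almost commute with `ψ(x) ≠ 0`, hence almost with each other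
(`norm_commutator_le`). Since `m'θ - mθ' = ±1`, it follows that `exp(±ψ(x)) ≈ 1`, with an error that
vanishes along the Fibonacci numbers. Thus `cos d = 1`. -/

/-- For an imaginary quaternion `p` of norm `d`, this is the exponential `exp (u • p)`. -/
def rot (d u : ℝ) (p : ℍ[ℝ]) : ℍ[ℝ] :=
  ((Real.cos (u * d) : ℝ) : ℍ[ℝ]) + (Real.sin (u * d) / d) • p

theorem star_eq_neg_of_re {p : ℍ[ℝ]} (hp : p.re = 0) : star p = -p := by
  ext <;> simp [hp]

theorem sq_eq_neg_of_re {p : ℍ[ℝ]} (hp : p.re = 0) : p * p = -((‖p‖ ^ 2 : ℝ) : ℍ[ℝ]) := by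
  have h := Quaternion.self_mul_star p
  rw [star_eq_neg_of_re hp, Quaternion.normSq_eq_norm_mul_self] at h
  rw [sq, ← h]
  simp

theorem rot_zero (d : ℝ) (p : ℍ[ℝ]) : rot d 0 p = 1 := by simp [rot]

theorem star_rot {d u : ℝ} {p : ℍ[ℝ]} (hp : p.re = 0) : star (rot d u p) = rot d (-u) p := by
  simp [rot, star_eq_neg_of_re hp, neg_div]

/-- Since `p² = -d²`, the plane `ℝ + ℝp` is a copy of `ℂ` with `p/d` as imaginary unit; the claim is
the addition formula for sine and cosine. -/
theorem rot_add {d : ℝ} (u v : ℝ) {p : ℍ[ℝ]} (hd : d ≠ 0) (hp : p.re = 0) (hpd : ‖p‖ = d) :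
    rot d (u + v) p = rot d u p * rot d v p := by
  have h := sq_eq_neg_of_re hp
  rw [hpd] at h
  have e : rot d u p * rot d v p = ((Real.cos (u * d) * Real.cos (v * d) : ℝ) : ℍ[ℝ]) +
      ((Real.cos (u * d) * (Real.sin (v * d) / d) + Real.sin (u * d) / d * Real.cos (v * d)) • p) +
      ((Real.sin (u * d) / d) * (Real.sin (v * d) / d)) • (p * p) := by
    simp only [rot, add_mul, mul_add, smul_mul_smul_comm, Quaternion.coe_mul_eq_smul,
      Quaternion.mul_coe_eq_smul, Quaternion.coe_mul, smul_smul, add_smul]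
    rw [mul_comm (Real.cos (v * d))]
    abel
  rw [e, h, rot, add_mul, Real.cos_add, Real.sin_add]
  have e2 : ((Real.sin (u * d) / d) * (Real.sin (v * d) / d)) • (-((d ^ 2 : ℝ) : ℍ[ℝ])) =
      ((-(Real.sin (u * d) * Real.sin (v * d)) : ℝ) : ℍ[ℝ]) := by
    rw [smul_neg, ← Quaternion.coe_mul_eq_smul, ← Quaternion.coe_mul, ← Quaternion.coe_neg]
    congr 2
    field_simp
  rw [e2]
  ext <;> simp only [Quaternion.re_add, Quaternion.imI_add, Quaternion.imJ_add, Quaternion.imK_add,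
    Quaternion.re_smul, Quaternion.imI_smul, Quaternion.imJ_smul, Quaternion.imK_smul,
    Quaternion.re_coe, Quaternion.imI_coe, Quaternion.imJ_coe, Quaternion.imK_coe,
    smul_eq_mul] <;> ring

theorem norm_rot {d : ℝ} (u : ℝ) {p : ℍ[ℝ]} (hd : d ≠ 0) (hp : p.re = 0) (hpd : ‖p‖ = d) :
    ‖rot d u p‖ = 1 := by
  have h : rot d u p * star (rot d u p) = 1 := by
    rw [star_rot hp, ← rot_add _ _ hd hp hpd, add_neg_cancel, rot_zero]
  have h2 := congrArg norm h
  rw [norm_mul, Quaternion.norm_star, norm_one] at h2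
  nlinarith [norm_nonneg (rot d u p)]

theorem hasDerivAt_rot {d : ℝ} (n u : ℝ) {p : ℍ[ℝ]} (hd : d ≠ 0) (hp : p.re = 0)
    (hpd : ‖p‖ = d) :
    HasDerivAt (fun s => rot d (n * s) p) (n • (rot d (n * u) p * p)) u := by
  have h := sq_eq_neg_of_re hp
  rw [hpd] at h
  have hl : HasDerivAt (fun s : ℝ => n * s * d) (n * d) u := by
    simpa using ((hasDerivAt_id u).const_mul n).mul_const d
  have h1 := (hl.cos.smul_const (1 : ℍ[ℝ])).add ((hl.sin.div_const d).smul_const p)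
  refine (h1.congr_deriv ?_).congr_of_eventuallyEq ?_
  · rw [rot, add_mul, smul_mul_assoc, h]
    have e1 : Real.cos (n * u * d) * (n * d) / d = n * Real.cos (n * u * d) := by field_simp
    have e2 : n * (Real.sin (n * u * d) / d * d ^ 2) = Real.sin (n * u * d) * (n * d) := by
      field_simp
    have e3 : n • ((Real.sin (n * u * d) / d) • -((d ^ 2 : ℝ) : ℍ[ℝ])) =
        -((Real.sin (n * u * d) * (n * d) : ℝ) : ℍ[ℝ]) := by
      rw [smul_neg, smul_neg, Quaternion.smul_coe, Quaternion.smul_coe, e2]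
    rw [smul_add, Quaternion.coe_mul_eq_smul, smul_smul, e1, e3, neg_mul, neg_smul,
      ← Quaternion.coe_mul_eq_smul (r := Real.sin _ * _), mul_one, add_comm]
  · refine Eventually.of_forall fun s => ?_
    simp only [rot, Pi.add_apply]
    rw [← Quaternion.coe_mul_eq_smul (r := Real.cos _), mul_one]

theorem abs_re_le_norm (q : ℍ[ℝ]) : |q.re| ≤ ‖q‖ := by
  have h := Quaternion.normSq_eq_norm_mul_self q
  rw [Quaternion.normSq_def'] at h
  exact abs_le_of_sq_le_sq (by nlinarith [sq_nonneg q.imI, sq_nonneg q.imJ, sq_nonneg q.imK])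
    (norm_nonneg _)

/-- The centralizer of a nonzero imaginary quaternion is the commutative plane `ℝ + ℝp`: commuting
with `p` means that the imaginary part has zero cross product with `p`. -/
theorem mul_comm_of_commute_im {a b p : ℍ[ℝ]} (hp : p.re = 0) (hp0 : p ≠ 0)
    (ha : a * p = p * a) (hb : b * p = p * b) : a * b = b * a := by
  have key : ∀ c : ℍ[ℝ], c * p = p * c → ∃ r s : ℝ, c = (r : ℍ[ℝ]) + s • p := by
    intro c hc
    have hn : p.imI ^ 2 + p.imJ ^ 2 + p.imK ^ 2 ≠ 0 := by
      have := Quaternion.normSq_ne_zero.2 hp0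
      rw [Quaternion.normSq_def', hp] at this
      simpa using this
    have h1 := congrArg (fun q : ℍ[ℝ] => q.imI) hc
    have h2 := congrArg (fun q : ℍ[ℝ] => q.imJ) hc
    have h3 := congrArg (fun q : ℍ[ℝ] => q.imK) hc
    simp only [Quaternion.imI_mul, Quaternion.imJ_mul, Quaternion.imK_mul, hp] at h1 h2 h3
    refine ⟨c.re, (c.imI * p.imI + c.imJ * p.imJ + c.imK * p.imK) /
      (p.imI ^ 2 + p.imJ ^ 2 + p.imK ^ 2), ?_⟩
    ext
    · simp [hp]
    · simp only [Quaternion.imI_add, Quaternion.imI_coe, Quaternion.imI_smul, zero_add]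
      rw [smul_eq_mul, div_mul_eq_mul_div, eq_div_iff hn]
      linear_combination (-p.imK / 2) * h2 + (p.imJ / 2) * h3
    · simp only [Quaternion.imJ_add, Quaternion.imJ_coe, Quaternion.imJ_smul, zero_add]
      rw [smul_eq_mul, div_mul_eq_mul_div, eq_div_iff hn]
      linear_combination (p.imK / 2) * h1 + (-p.imI / 2) * h3
    · simp only [Quaternion.imK_add, Quaternion.imK_coe, Quaternion.imK_smul, zero_add]
      rw [smul_eq_mul, div_mul_eq_mul_div, eq_div_iff hn]
      linear_combination (-p.imJ / 2) * h1 + (p.imI / 2) * h2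
  obtain ⟨r, s, rfl⟩ := key a ha
  obtain ⟨r', s', rfl⟩ := key b hb
  ext <;> simp <;> ring

/-- Elements that nearly commute with a nonzero imaginary quaternion nearly commute. -/
theorem norm_commutator_le {d : ℝ} {a b p : ℍ[ℝ]} (hd : 0 < d) (hp : p.re = 0) (hpd : ‖p‖ = d)
    (ha : ‖a‖ = 1) (hb : ‖b‖ = 1) :
    ‖a * b - b * a‖ ≤ 1 / d * (‖a * p - p * a‖ + ‖b * p - p * b‖) := by
  have h := sq_eq_neg_of_re hp
  rw [hpd] at h
  have hd0 : d ≠ 0 := hd.ne'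
  have hp0 : p ≠ 0 := norm_ne_zero_iff.1 (by rw [hpd]; exact hd0)
  have key : ∀ c : ℍ[ℝ], ‖c‖ = 1 → ∃ c' : ℍ[ℝ], c' * p = p * c' ∧ ‖c'‖ ≤ 1 ∧
      ‖c - c'‖ = 1 / (2 * d) * ‖c * p - p * c‖ := by
    intro c hc
    have e : (d ^ 2) • c = -(c * p * p) := by
      rw [mul_assoc, h, mul_neg, neg_neg, Quaternion.mul_coe_eq_smul]
    have e' : (d ^ 2) • c = -(p * (p * c)) := by
      rw [← mul_assoc, h, neg_mul, neg_neg, Quaternion.coe_mul_eq_smul]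
    have hc' : c = (d ^ 2)⁻¹ • ((d ^ 2) • c) := by
      rw [smul_smul, inv_mul_cancel₀ (by positivity), one_smul]
    -- As `p⁻¹ = -p/d²`, this witness is the average of `c` and `p c p⁻¹`, the projection of `c`
    -- onto the centralizer of `p`.
    refine ⟨(1 / 2 : ℝ) • (c - (d ^ 2)⁻¹ • (p * c * p)), ?_, ?_, ?_⟩
    · have e1 : c * p = -((d ^ 2)⁻¹ • (p * (p * c) * p)) := by
        conv_lhs => rw [hc', e']
        simp
      have e2 : p * c = -((d ^ 2)⁻¹ • (p * (c * p * p))) := by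
        conv_lhs => rw [hc', e]
        simp
      rw [smul_mul_assoc, mul_smul_comm, sub_mul, mul_sub, smul_mul_assoc, mul_smul_comm]
      congr 1
      have e3 : (d ^ 2)⁻¹ • (p * c * p * p) = -(p * c) := by
        conv_rhs => rw [e2, neg_neg]
        simp only [mul_assoc]
      have e4 : (d ^ 2)⁻¹ • (p * (p * c * p)) = -(c * p) := by
        conv_rhs => rw [e1, neg_neg]
        simp only [mul_assoc]
      rw [e3, e4]
      abel
    · rw [norm_smul]
      have : ‖c - (d ^ 2)⁻¹ • (p * c * p)‖ ≤ 2 := by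
        refine (norm_sub_le _ _).trans ?_
        rw [norm_smul, norm_mul, norm_mul, hpd, hc, Real.norm_of_nonneg (by positivity)]
        have : (d ^ 2)⁻¹ * (d * 1 * d) = 1 := by field_simp
        linarith
      rw [Real.norm_of_nonneg (by norm_num)]
      linarith
    · have : c - (1 / 2 : ℝ) • (c - (d ^ 2)⁻¹ • (p * c * p)) =
          (-(1 / 2 * (d ^ 2)⁻¹) : ℝ) • ((c * p - p * c) * p) := by
        have e5 : (d ^ 2)⁻¹ • (c * p * p) = - c := by
          conv_rhs => rw [hc', e]
          simp
        rw [sub_mul, neg_smul, mul_smul, smul_sub _ (c * p * p), e5]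
        module
      rw [this, norm_smul, norm_mul, hpd, norm_neg, Real.norm_of_nonneg (by positivity)]
      field_simp
  obtain ⟨a', h1, h2, h3⟩ := key a ha
  obtain ⟨b', h4, h5, h6⟩ := key b hb
  have hc := mul_comm_of_commute_im hp hp0 h1 h4
  -- Telescoping from `ab - ba` to `a'b' - b'a'`, which vanishes.
  have e : a * b - b * a = (a - a') * b + a' * (b - b') - (b - b') * a - b' * (a - a') := by
    simp only [sub_mul, mul_sub]
    rw [hc]
    abel
  have hA := norm_nonneg (a - a')
  have hB := norm_nonneg (b - b')
  calc ‖a * b - b * a‖ ≤ ‖(a - a') * b‖ + ‖a' * (b - b')‖ + ‖(b - b') * a‖ + ‖b' * (a - a')‖ := by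
        rw [e]
        exact (norm_sub_le _ _).trans (add_le_add_left ((norm_sub_le _ _).trans
          (add_le_add_left (norm_add_le _ _) _)) _)
    _ ≤ 2 * (‖a - a'‖ + ‖b - b'‖) := by
        simp only [norm_mul, ha, hb]
        nlinarith
    _ = _ := by
        rw [h3, h6]
        field_simp

/-! ### The identification of `SU(2)` with the unit quaternions -/

/-- The standard embedding of the quaternions into the `2 × 2` complex matrices. -/
def toMat (q : ℍ[ℝ]) : Matrix (Fin 2) (Fin 2) ℂ :=
  !![⟨q.re, q.imI⟩, ⟨q.imJ, q.imK⟩; ⟨-q.imJ, q.imK⟩, ⟨q.re, -q.imI⟩]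

/-- The quaternion read off from the first row of a matrix. -/
def toQuat (M : Matrix (Fin 2) (Fin 2) ℂ) : ℍ[ℝ] :=
  ⟨(M 0 0).re, (M 0 0).im, (M 0 1).re, (M 0 1).im⟩

theorem toQuat_toMat (q : ℍ[ℝ]) : toQuat (toMat q) = q := by
  ext <;> simp [toQuat, toMat]

theorem toMat_mul (p q : ℍ[ℝ]) : toMat (p * q) = toMat p * toMat q := by
  ext i j
  fin_cases i <;> fin_cases j <;> apply Complex.ext <;>
    simp [toMat, Matrix.mul_apply, Fin.sum_univ_two] <;> ring

theorem toMat_one : toMat 1 = 1 := by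
  ext i j
  fin_cases i <;> fin_cases j <;> apply Complex.ext <;> simp [toMat]

theorem toMat_sub (p q : ℍ[ℝ]) : toMat (p - q) = toMat p - toMat q := by
  ext i j
  fin_cases i <;> fin_cases j <;> apply Complex.ext <;> simp [toMat] <;> ring

theorem toMat_smul (r : ℝ) (q : ℍ[ℝ]) : toMat (r • q) = r • toMat q := by
  ext i j
  fin_cases i <;> fin_cases j <;> apply Complex.ext <;> simp [toMat]

theorem hsNorm_toMat (q : ℍ[ℝ]) : hsNorm (toMat q) = ‖q‖ := by
  rw [hsNorm, norm_eq_sqrt_real_inner, Quaternion.inner_self, Quaternion.normSq_def']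
  congr 1
  simp [toMat, Fin.sum_univ_two, ← Complex.normSq_eq_norm_sq, Complex.normSq_apply]
  ring

theorem toMat_mem_su2 {q : ℍ[ℝ]} (hq : q.re = 0) : toMat q ∈ su2 := by
  refine ⟨?_, ?_⟩
  · ext i j
    fin_cases i <;> fin_cases j <;> apply Complex.ext <;> simp [toMat, hq]
  · apply Complex.ext <;> simp [toMat, Matrix.trace, hq]

theorem continuous_toMat : Continuous toMat := by
  have hre := Quaternion.continuous_re
  have hI := Quaternion.continuous_imI
  have hJ := Quaternion.continuous_imJ
  have hK := Quaternion.continuous_imK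
  have hc : ∀ a b : ℍ[ℝ] → ℝ, Continuous a → Continuous b →
      Continuous fun q => (⟨a q, b q⟩ : ℂ) := fun a b ha hb =>
    Complex.equivRealProdCLM.symm.continuous.comp (ha.prodMk hb)
  refine continuous_matrix fun i j => ?_
  fin_cases i <;> fin_cases j
  · exact hc _ _ hre hI
  · exact hc _ _ hJ hK
  · exact hc _ _ hJ.neg hK
  · exact hc _ _ hre hI.neg

/-- The entries of `toMat` as continuous linear maps. -/
def toMatEntry (i j : Fin 2) : ℍ[ℝ] →L[ℝ] ℂ where
  toFun q := toMat q i j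
  map_add' p q := by
    fin_cases i <;> fin_cases j <;> apply Complex.ext <;> simp [toMat] <;> ring
  map_smul' r q := by simp [toMat_smul]
  cont := continuous_toMat.matrix_elem i j

/-- In `SU(2)` the adjoint equals the adjugate, so the second row is determined by the first, in the
pattern of `toMat`. -/
theorem toMat_toQuat (M : SU2) : toMat (toQuat M.1) = M.1 := by
  obtain ⟨M, hM⟩ := M
  obtain ⟨hU, hdet⟩ := Matrix.mem_specialUnitaryGroup_iff.1 hM
  have h1 : star M = M.adjugate := by
    have : star M * (M * M.adjugate) = M.adjugate := by
      rw [← mul_assoc, (Matrix.mem_unitaryGroup_iff'.1 hU), one_mul]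
    rw [← this, Matrix.mul_adjugate, hdet, one_smul, mul_one]
  rw [Matrix.adjugate_fin_two] at h1
  have h00 := congrFun (congrFun h1 0) 0
  have h01 := congrFun (congrFun h1 0) 1
  simp [Matrix.star_apply] at h00 h01
  ext i j
  fin_cases i <;> fin_cases j <;> apply Complex.ext <;> simp [toMat, toQuat, ← h00]
  · have := congrArg Complex.re h01; simp at this; linarith
  · have := congrArg Complex.im h01; simp at this; linarith

theorem norm_toQuat (M : SU2) : ‖toQuat M.1‖ = 1 := by
  have hdet := (Matrix.mem_specialUnitaryGroup_iff.1 M.2).2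
  rw [← toMat_toQuat M, Matrix.det_fin_two] at hdet
  have h := congrArg Complex.re hdet
  have e := Quaternion.normSq_eq_norm_mul_self (toQuat M.1)
  rw [Quaternion.normSq_def'] at e
  simp [toMat] at h
  nlinarith [norm_nonneg (toQuat M.1)]

theorem toQuat_mul (M N : SU2) : toQuat (M * N).1 = toQuat M.1 * toQuat N.1 := by
  have : (M * N).1 = toMat (toQuat M.1 * toQuat N.1) := by
    rw [toMat_mul, toMat_toQuat, toMat_toQuat]; rfl
  rw [this, toQuat_toMat]

theorem toMat_star_toQuat (M : SU2) : toMat (star (toQuat M.1)) = (M⁻¹ : SU2).1 := by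
  have h : toQuat (M⁻¹).1 = star (toQuat M.1) := by
    have h1 : toQuat (M * M⁻¹).1 = 1 := by
      rw [mul_inv_cancel, show ((1 : SU2).1) = toMat 1 from toMat_one.symm, toQuat_toMat]
    rw [toQuat_mul] at h1
    have h2 : star (toQuat M.1) * toQuat M.1 = 1 := by
      rw [Quaternion.star_mul_self, Quaternion.normSq_eq_norm_mul_self, norm_toQuat]; simp
    rw [← one_mul (toQuat (M⁻¹).1), ← h2, mul_assoc, h1, mul_one]
  rw [← h, toMat_toQuat]

variable {X : Type*}

/-! ### The maximal ergodic inequality -/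

section Maximal

/-- The maximal function `max_{0 ≤ k ≤ n} ∑_{j < k} g ∘ T^j`. -/
def maxSum (T : X → X) (g : X → ℝ) : ℕ → X → ℝ
  | 0, _ => 0
  | n + 1, x => max 0 (g x + maxSum T g n (T x))

variable {T : X → X} {g : X → ℝ}

theorem maxSum_nonneg (n : ℕ) (x : X) : 0 ≤ maxSum T g n x := by
  cases n with
  | zero => exact le_rfl
  | succ n => exact le_max_left _ _

theorem maxSum_le_succ (n : ℕ) (x : X) : maxSum T g n x ≤ maxSum T g (n + 1) x := by
  induction n generalizing x with
  | zero => exact maxSum_nonneg _ _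
  | succ n ih => exact max_le_max le_rfl (add_le_add_right (ih (T x)) _)

theorem birkhoffSum_le_maxSum {k n : ℕ} (hk : k ≤ n) (x : X) :
    birkhoffSum T g k x ≤ maxSum T g n x := by
  induction n generalizing k x with
  | zero =>
    obtain rfl : k = 0 := by omega
    simp [maxSum]
  | succ n ih =>
    cases k with
    | zero => simpa using maxSum_nonneg _ _
    | succ k =>
      rw [birkhoffSum_succ']
      exact le_max_of_le_right (add_le_add_right (ih (by omega) (T x)) _)

variable [MeasurableSpace X] {μ : Measure X}

theorem measurable_maxSum (hT : Measurable T) (hg : Measurable g) (n : ℕ) :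
    Measurable (maxSum T g n) := by
  induction n with
  | zero => exact measurable_const
  | succ n ih => exact measurable_const.max (hg.add (ih.comp hT))

theorem integrable_maxSum (hT : MeasurePreserving T μ μ) (hg : Integrable g μ) (n : ℕ) :
    Integrable (maxSum T g n) μ := by
  induction n with
  | zero => exact integrable_zero _ _ _
  | succ n ih =>
    exact (integrable_zero _ _ _).sup (hg.add (hT.integrable_comp_of_integrable ih))

/-- Hopf's maximal ergodic theorem. -/
theorem setIntegral_maxSum_pos_nonneg (hT : MeasurePreserving T μ μ) (hgm : Measurable g)
    (hg : Integrable g μ) (n : ℕ) : 0 ≤ ∫ x in {x | 0 < maxSum T g n x}, g x ∂μ := by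
  cases n with
  | zero => simp [maxSum]
  | succ n =>
    have hM := integrable_maxSum hT hg (n + 1)
    have hMT := hT.integrable_comp_of_integrable hM
    have hs : MeasurableSet {x | 0 < maxSum T g (n + 1) x} :=
      measurableSet_lt measurable_const (measurable_maxSum hT.measurable hgm _)
    have h0 : ∫ x, maxSum T g (n + 1) x - maxSum T g (n + 1) (T x) ∂μ = 0 := by
      have e : ∫ x, maxSum T g (n + 1) (T x) ∂μ = ∫ x, maxSum T g (n + 1) x ∂μ := by
        have := integral_map (μ := μ) (f := maxSum T g (n + 1)) hT.measurable.aemeasurable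
          (by rw [hT.map_eq]; exact hM.aestronglyMeasurable)
        rw [hT.map_eq] at this
        exact this.symm
      have := integral_sub hM hMT
      simp only [Function.comp_apply] at this
      rw [this, e, sub_self]
    refine h0.ge.trans ?_
    rw [← integral_indicator hs]
    refine integral_mono (hM.sub hMT) (hg.indicator hs) fun x => ?_
    -- Let `M` be the maximal sum. Where `M > 0` the recursion and monotonicity in `n` give `M - M ∘
    -- T ≤ g`; elsewhere `M = 0 ≤ M ∘ T`. Integrating and using invariance of the measure gives the
    -- result.
    by_cases hx : 0 < maxSum T g (n + 1) x
    · rw [Set.indicator_of_mem (by exact hx)]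
      have h1 : maxSum T g (n + 1) x = g x + maxSum T g n (T x) := by
        rcases max_choice 0 (g x + maxSum T g n (T x)) with h | h
        · exact absurd (h : maxSum T g (n + 1) x = 0) hx.ne'
        · exact h
      have h2 := maxSum_le_succ (T := T) (g := g) n (T x)
      linarith
    · rw [Set.indicator_of_notMem (by exact hx)]
      have h2 := maxSum_nonneg (T := T) (g := g) (n + 1) (T x)
      linarith

/-- The weak type `(1, 1)` maximal inequality for Birkhoff averages of nonnegative functions. -/
theorem measure_exists_birkhoffSum_gt_le [IsProbabilityMeasure μ] (hT : MeasurePreserving T μ μ)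
    {h : X → ℝ} (hm : Measurable h) (hi : Integrable h μ) (h0 : ∀ x, 0 ≤ h x) {c : ℝ}
    (hc : 0 < c) :
    μ {x | ∃ n, n * c < birkhoffSum T h n x} ≤ ENNReal.ofReal ((∫ x, h x ∂μ) / c) := by
  -- A Birkhoff average of `h` exceeds `c` exactly when a Birkhoff sum of `h - c` is positive, so
  -- Hopf's theorem applies to `h - c`.
  set g : X → ℝ := fun x => h x - c with hg
  have hgm : Measurable g := hm.sub_const c
  have hgi : Integrable g μ := hi.sub (integrable_const c)
  have hsub : {x | ∃ n, n * c < birkhoffSum T h n x} ⊆ ⋃ n, {x | 0 < maxSum T g n x} := by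
    rintro x ⟨n, hn⟩
    refine Set.mem_iUnion.2 ⟨n, lt_of_lt_of_le ?_ (birkhoffSum_le_maxSum le_rfl x)⟩
    have : birkhoffSum T g n x = birkhoffSum T h n x - n * c := by
      simp [birkhoffSum, hg, Finset.sum_sub_distrib]
    rw [this]
    linarith
  have hmono : Monotone fun n => {x | 0 < maxSum T g n x} :=
    monotone_nat_of_le_succ fun n x hx => lt_of_lt_of_le hx (maxSum_le_succ n x)
  refine (measure_mono hsub).trans ?_
  rw [hmono.measure_iUnion]
  refine iSup_le fun n => ?_
  have hs : MeasurableSet {x | 0 < maxSum T g n x} :=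
    measurableSet_lt measurable_const (measurable_maxSum hT.measurable hgm _)
  have h1 := setIntegral_maxSum_pos_nonneg hT hgm hgi n
  rw [integral_sub hi.integrableOn (integrable_const c).integrableOn, setIntegral_const,
    smul_eq_mul] at h1
  have h2 := setIntegral_le_integral (s := {x | 0 < maxSum T g n x}) hi (ae_of_all _ h0)
  rw [← ofReal_measureReal]
  refine ENNReal.ofReal_le_ofReal ?_
  rw [le_div_iff₀ hc]
  linarith

end Maximal

/-! ### Ergodic theorems for conjugation cocycles -/

section Transfer

/-- The operator `g ↦ Ad_Q (g ∘ T)` on quaternion valued functions. -/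
def transfer (T : X → X) (Q : X → ℍ[ℝ]) : (X → ℍ[ℝ]) →ₗ[ℝ] (X → ℍ[ℝ]) where
  toFun g x := Q x * g (T x) * star (Q x)
  map_add' g h := by ext1 x; simp [mul_add, add_mul]
  map_smul' r g := by ext1 x; simp

/-- The Cesàro averages of the iterates of `transfer T Q`. -/
def transferAvg (T : X → X) (Q : X → ℍ[ℝ]) (n : ℕ) (g : X → ℍ[ℝ]) (x : X) : ℍ[ℝ] :=
  (n : ℝ)⁻¹ • ∑ k ∈ Finset.range n, (transfer T Q)^[k] g x

variable {T : X → X} {Q : X → ℍ[ℝ]}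

theorem transfer_apply (g : X → ℍ[ℝ]) (x : X) :
    transfer T Q g x = Q x * g (T x) * star (Q x) := rfl

/-- Conjugation by a unit quaternion is an isometry. This gives the contraction on `L²`, the
domination of averages by scalar Birkhoff averages, and the invariance of `‖ψ‖`. -/
theorem norm_transfer_iterate (hQ : ∀ x, ‖Q x‖ = 1) (k : ℕ) (g : X → ℍ[ℝ]) (x : X) :
    ‖(transfer T Q)^[k] g x‖ = ‖g (T^[k] x)‖ := by
  induction k generalizing x with
  | zero => rfl
  | succ k ih =>
    rw [Function.iterate_succ_apply', transfer_apply, norm_mul, norm_mul, Quaternion.norm_star, hQ,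
      one_mul, mul_one, ih, Function.iterate_succ_apply]

theorem norm_transferAvg_le (hQ : ∀ x, ‖Q x‖ = 1) (n : ℕ) (g : X → ℍ[ℝ]) (x : X) :
    ‖transferAvg T Q n g x‖ ≤ (n : ℝ)⁻¹ * birkhoffSum T (fun y => ‖g y‖) n x := by
  rw [transferAvg, norm_smul, Real.norm_of_nonneg (by positivity)]
  gcongr
  refine (norm_sum_le _ _).trans (le_of_eq ?_)
  simp [birkhoffSum, norm_transfer_iterate hQ]

theorem transferAvg_eq_birkhoffAverage (n : ℕ) (g : X → ℍ[ℝ]) (x : X) :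
    transferAvg T Q n g x =
      birkhoffAverage ℝ (transfer T Q) (fun F : X → ℍ[ℝ] => F x) n g := rfl

theorem transferAvg_sub (n : ℕ) (g h : X → ℍ[ℝ]) (x : X) :
    transferAvg T Q n (g - h) x = transferAvg T Q n g x - transferAvg T Q n h x := by
  simp only [transferAvg, ← Module.End.pow_apply, map_sub, Pi.sub_apply, Finset.sum_sub_distrib,
    smul_sub]

theorem transferAvg_sum_smul (n : ℕ) (r : ℝ) (s : Finset ℕ) (g : ℕ → X → ℍ[ℝ]) (x : X) :
    transferAvg T Q n (r • ∑ j ∈ s, g j) x = r • ∑ j ∈ s, transferAvg T Q n (g j) x := by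
  simp only [transferAvg, ← Module.End.pow_apply, map_smul, map_sum, Pi.smul_apply,
    Finset.sum_apply, Finset.smul_sum]
  rw [Finset.sum_comm]
  exact Finset.sum_congr rfl fun _ _ => Finset.sum_congr rfl fun _ _ => smul_comm _ _ _

/-- The averages of a bounded function and of its averages have the same asymptotics. -/
theorem tendsto_transferAvg_sub_transferAvg (hQ : ∀ x, ‖Q x‖ = 1) {f : X → ℍ[ℝ]} {C : ℝ}
    (hf : ∀ x, ‖f x‖ ≤ C) {N : ℕ} (hN : N ≠ 0) (x : X) :
    Tendsto (fun n => transferAvg T Q n (transferAvg T Q N f) x - transferAvg T Q n f x)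
      atTop (𝓝 0) := by
  have hb : ∀ j, Bornology.IsBounded
      (Set.range fun k => (fun F : X → ℍ[ℝ] => F x) ((transfer T Q)^[k] ((transfer T Q)^[j] f))) :=
    fun j => isBounded_iff_forall_norm_le.2 ⟨C, Set.forall_mem_range.2 fun k => by
      simp only [norm_transfer_iterate hQ]
      exact hf _⟩
  -- Shifting the starting point by one step changes the average only by boundary terms of size
  -- `O(1/n)`; the claim follows by averaging over `j < N`.
  have h1 : ∀ j, Tendsto (fun n => transferAvg T Q n ((transfer T Q)^[j] f) x -
      transferAvg T Q n f x) atTop (𝓝 0) := by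
    intro j
    induction j with
    | zero => simp
    | succ j ih =>
      have := tendsto_birkhoffAverage_apply_sub_birkhoffAverage ℝ (f := transfer T Q)
        (g := fun F : X → ℍ[ℝ] => F x) (x := (transfer T Q)^[j] f) (hb j)
      rw [← zero_add (0 : ℍ[ℝ])]
      refine (this.add ih).congr fun n => ?_
      rw [Function.iterate_succ_apply', transferAvg_eq_birkhoffAverage,
        transferAvg_eq_birkhoffAverage, transferAvg_eq_birkhoffAverage]
      abel
  have h2 : Tendsto (fun n => (N : ℝ)⁻¹ • ∑ j ∈ Finset.range N,
      (transferAvg T Q n ((transfer T Q)^[j] f) x - transferAvg T Q n f x)) atTop (𝓝 0) := by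
    have := (tendsto_finsetSum (Finset.range N) fun j _ => h1 j).const_smul (N : ℝ)⁻¹
    simpa using this
  refine h2.congr fun n => ?_
  have e : transferAvg T Q N f = (N : ℝ)⁻¹ • ∑ j ∈ Finset.range N, (transfer T Q)^[j] f := by
    ext1 y
    simp [transferAvg]
  rw [e, transferAvg_sum_smul, Finset.sum_sub_distrib, smul_sub, Finset.sum_const,
    Finset.card_range, ← Nat.cast_smul_eq_nsmul ℝ, smul_smul,
    inv_mul_cancel₀ (Nat.cast_ne_zero.2 hN), one_smul]

variable [MeasurableSpace X] {μ : Measure X}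

theorem stronglyMeasurable_transfer (hT : Measurable T) (hQ : StronglyMeasurable Q)
    {g : X → ℍ[ℝ]} (hg : StronglyMeasurable g) : StronglyMeasurable (transfer T Q g) :=
  (hQ.mul (hg.comp_measurable hT)).mul (continuous_star.comp_stronglyMeasurable hQ)

theorem stronglyMeasurable_transferAvg (hT : Measurable T) (hQ : StronglyMeasurable Q)
    {g : X → ℍ[ℝ]} (hg : StronglyMeasurable g) (n : ℕ) :
    StronglyMeasurable (transferAvg T Q n g) := by
  have h : ∀ k, StronglyMeasurable ((transfer T Q)^[k] g) := fun k => by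
    induction k with
    | zero => exact hg
    | succ k ih =>
      rw [Function.iterate_succ_apply']
      exact stronglyMeasurable_transfer hT hQ ih
  exact (Finset.stronglyMeasurable_fun_sum (f := fun k => (transfer T Q)^[k] g)
    (Finset.range n) fun k _ => h k).const_smul (n : ℝ)⁻¹

theorem transfer_congr_ae (hT : MeasurePreserving T μ μ) {g h : X → ℍ[ℝ]} (e : g =ᵐ[μ] h) :
    transfer T Q g =ᵐ[μ] transfer T Q h := by
  filter_upwards [hT.quasiMeasurePreserving.ae_eq_comp e] with x hx
  simp only [Function.comp_apply] at hx
  rw [transfer_apply, transfer_apply, hx]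

theorem transfer_iterate_congr_ae (hT : MeasurePreserving T μ μ) {g h : X → ℍ[ℝ]} (e : g =ᵐ[μ] h)
    (k : ℕ) : (transfer T Q)^[k] g =ᵐ[μ] (transfer T Q)^[k] h := by
  induction k with
  | zero => exact e
  | succ k ih =>
    rw [Function.iterate_succ_apply', Function.iterate_succ_apply']
    exact transfer_congr_ae hT ih

theorem transfer_iterate_fixed_ae (hT : MeasurePreserving T μ μ) {g : X → ℍ[ℝ]}
    (e : transfer T Q g =ᵐ[μ] g) (k : ℕ) : (transfer T Q)^[k] g =ᵐ[μ] g := by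
  induction k with
  | zero => rfl
  | succ k ih =>
    rw [Function.iterate_succ_apply']
    exact (transfer_congr_ae hT ih).trans e

theorem memLp_transfer (hT : MeasurePreserving T μ μ) (hQm : StronglyMeasurable Q)
    (hQ : ∀ x, ‖Q x‖ = 1) {p : ℝ≥0∞} (g : Lp ℍ[ℝ] p μ) : MemLp (transfer T Q g) p μ :=
  ((Lp.memLp g).comp_measurePreserving hT).congr_norm
    (stronglyMeasurable_transfer hT.measurable hQm (Lp.stronglyMeasurable g)).aestronglyMeasurable
    (ae_of_all _ fun x => (norm_transfer_iterate hQ 1 g x).symm)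

/-- `transfer T Q` as a contraction of `L²`. -/
def transferLp (hT : MeasurePreserving T μ μ) (hQm : StronglyMeasurable Q)
    (hQ : ∀ x, ‖Q x‖ = 1) : Lp ℍ[ℝ] 2 μ →L[ℝ] Lp ℍ[ℝ] 2 μ :=
  LinearMap.mkContinuous
    { toFun := fun g => (memLp_transfer hT hQm hQ g).toLp _
      map_add' := fun g h => by
        ext1
        refine (MemLp.coeFn_toLp _).trans (((transfer_congr_ae hT (Lp.coeFn_add g h)).trans ?_).trans
          (Lp.coeFn_add _ _).symm)
        rw [map_add]
        exact ((MemLp.coeFn_toLp _).add (MemLp.coeFn_toLp _)).symm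
      map_smul' := fun r g => by
        ext1
        refine (MemLp.coeFn_toLp _).trans (((transfer_congr_ae hT (Lp.coeFn_smul r g)).trans
          ?_).trans (Lp.coeFn_smul _ _).symm)
        rw [map_smul]
        exact (EventuallyEq.const_smul (MemLp.coeFn_toLp _) r).symm } 1
    fun g => by
      rw [one_mul, ← Lp.norm_compMeasurePreserving g hT]
      refine Lp.norm_le_norm_of_ae_le ?_
      filter_upwards [MemLp.coeFn_toLp (memLp_transfer hT hQm hQ g),
        Lp.coeFn_compMeasurePreserving g hT] with x hx hx'
      rw [hx']
      refine (congrArg norm hx).le.trans (norm_transfer_iterate hQ 1 g x).le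

theorem coeFn_transferLp (hT : MeasurePreserving T μ μ) (hQm : StronglyMeasurable Q)
    (hQ : ∀ x, ‖Q x‖ = 1) (g : Lp ℍ[ℝ] 2 μ) :
    transferLp hT hQm hQ g =ᵐ[μ] transfer T Q g :=
  MemLp.coeFn_toLp (memLp_transfer hT hQm hQ g)

theorem coeFn_transferLp_iterate (hT : MeasurePreserving T μ μ) (hQm : StronglyMeasurable Q)
    (hQ : ∀ x, ‖Q x‖ = 1) (g : Lp ℍ[ℝ] 2 μ) (k : ℕ) :
    (transferLp hT hQm hQ)^[k] g =ᵐ[μ] (transfer T Q)^[k] g := by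
  induction k with
  | zero => rfl
  | succ k ih =>
    rw [Function.iterate_succ_apply', Function.iterate_succ_apply']
    exact (coeFn_transferLp hT hQm hQ _).trans (transfer_congr_ae hT ih)

/-- The mean ergodic theorem for `transfer T Q`. -/
theorem exists_tendsto_eLpNorm_transferAvg (hT : MeasurePreserving T μ μ)
    (hQm : StronglyMeasurable Q) (hQ : ∀ x, ‖Q x‖ = 1) {f : X → ℍ[ℝ]} (hf : MemLp f 2 μ) :
    ∃ ψ : X → ℍ[ℝ], StronglyMeasurable ψ ∧ MemLp ψ 2 μ ∧ transfer T Q ψ =ᵐ[μ] ψ ∧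
      Tendsto (fun n => eLpNorm (transferAvg T Q n f - ψ) 2 μ) atTop (𝓝 0) := by
  set U := transferLp hT hQm hQ with hU
  have hU1 : ‖U‖ ≤ 1 := LinearMap.mkContinuous_norm_le _ zero_le_one _
  have key := U.tendsto_birkhoffAverage_orthogonalProjection hU1 (hf.toLp f)
  set ψ := (U.eqLocus (1 : Lp ℍ[ℝ] 2 μ →L[ℝ] Lp ℍ[ℝ] 2 μ)).orthogonalProjectionOnto (hf.toLp f)
  refine ⟨(ψ : Lp ℍ[ℝ] 2 μ), Lp.stronglyMeasurable _, Lp.memLp _, ?_, ?_⟩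
  · have h := ψ.2
    have h' : U (ψ : Lp ℍ[ℝ] 2 μ) = ψ := h
    exact (coeFn_transferLp hT hQm hQ _).symm.trans (by rw [← hU, h'])
  · rw [tendsto_iff_edist_tendsto_0] at key
    refine key.congr fun n => ?_
    rw [Lp.edist_def]
    refine eLpNorm_congr_ae (EventuallyEq.sub ?_ EventuallyEq.rfl)
    rw [birkhoffAverage]
    refine (Lp.coeFn_smul _ _).trans ?_
    have hs : ∀ s : Finset ℕ, (↑(∑ k ∈ s, U^[k] (hf.toLp f)) : X → ℍ[ℝ]) =ᵐ[μ]
        fun x => ∑ k ∈ s, (transfer T Q)^[k] f x := by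
      intro s
      induction s using Finset.induction_on with
      | empty => exact Lp.coeFn_zero ℍ[ℝ] 2 μ
      | insert a s ha ih =>
        rw [Finset.sum_insert ha]
        filter_upwards [Lp.coeFn_add (U^[a] (hf.toLp f)) (∑ k ∈ s, U^[k] (hf.toLp f)), ih,
          (coeFn_transferLp_iterate hT hQm hQ (hf.toLp f) a).trans
            (transfer_iterate_congr_ae hT hf.coeFn_toLp a)] with x h1 h2 h3
        rw [h1, Pi.add_apply, h2, h3, Finset.sum_insert ha]
    filter_upwards [hs (Finset.range n)] with x hx
    rw [Pi.smul_apply, transferAvg, ← hx]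
    rfl

/-- The pointwise ergodic theorem for `transfer T Q` on bounded functions, given an `L²` limit. -/
theorem ae_tendsto_transferAvg [IsProbabilityMeasure μ] (hT : MeasurePreserving T μ μ)
    (hQm : StronglyMeasurable Q) (hQ : ∀ x, ‖Q x‖ = 1) {f : X → ℍ[ℝ]} {C : ℝ}
    (hfm : StronglyMeasurable f) (hf : ∀ x, ‖f x‖ ≤ C) {ψ : X → ℍ[ℝ]}
    (hψm : StronglyMeasurable ψ) (hψ : MemLp ψ 2 μ) (hinv : transfer T Q ψ =ᵐ[μ] ψ)
    (hlim : Tendsto (fun n => eLpNorm (transferAvg T Q n f - ψ) 2 μ) atTop (𝓝 0)) :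
    ∀ᵐ x ∂μ, Tendsto (fun n => transferAvg T Q n f x) atTop (𝓝 (ψ x)) := by
  have hfix : ∀ᵐ x ∂μ, ∀ k, (transfer T Q)^[k] ψ x = ψ x :=
    ae_all_iff.2 fun k => transfer_iterate_fixed_ae hT hinv k
  have hAm := stronglyMeasurable_transferAvg hT.measurable hQm hfm
  have hAb : ∀ n x, ‖transferAvg T Q n f x‖ ≤ C := by
    intro n x
    refine (norm_transferAvg_le hQ n f x).trans ?_
    have : birkhoffSum T (fun y => ‖f y‖) n x ≤ n * C := by
      refine (Finset.sum_le_card_nsmul _ _ C fun k _ => hf _).trans (by simp)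
    have hC : 0 ≤ C := (norm_nonneg _).trans (hf x)
    calc (n : ℝ)⁻¹ * birkhoffSum T (fun y => ‖f y‖) n x ≤ (n : ℝ)⁻¹ * (n * C) := by gcongr
      _ ≤ C := by
        rw [← mul_assoc]
        exact mul_le_of_le_one_left hC inv_mul_le_one
  have hAL : ∀ n, MemLp (transferAvg T Q n f - ψ) 2 μ := fun n =>
    (MemLp.of_bound (hAm n).aestronglyMeasurable C (ae_of_all _ (hAb n))).sub hψ
  have hint : Tendsto (fun n => ∫ x, ‖(transferAvg T Q n f - ψ) x‖ ∂μ) atTop (𝓝 0) := by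
    have h1 : Tendsto (fun n => eLpNorm (transferAvg T Q n f - ψ) 1 μ) atTop (𝓝 0) :=
      tendsto_of_tendsto_of_tendsto_of_le_of_le tendsto_const_nhds hlim (fun _ => zero_le)
        fun n => eLpNorm_le_eLpNorm_of_exponent_le (by norm_num) (hAL n).aestronglyMeasurable
    have h2 := (ENNReal.tendsto_toReal ENNReal.zero_ne_top).comp h1
    refine h2.congr fun n => ?_
    rw [Function.comp_apply, eLpNorm_one_eq_lintegral_enorm,
      integral_norm_eq_lintegral_enorm (hAL n).aestronglyMeasurable]
  -- With `A_n` the averages, `A_n f - ψ = A_n(A_N f - ψ) - (A_n A_N f - A_n f)`, and the last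
  -- bracket tends to `0`. So the bad set lies, up to a null set, where the maximal function of
  -- `‖A_N f - ψ‖` exceeds `c`. Its measure is at most `‖A_N f - ψ‖₁ / c`, and `N` is arbitrary.
  have hbad : ∀ c : ℝ, 0 < c →
      ∀ᵐ x ∂μ, ∀ᶠ n in atTop, ‖transferAvg T Q n f x - ψ x‖ < 2 * c := by
    intro c hc
    have hN : ∀ N, N ≠ 0 → μ {x | ¬ ∀ᶠ n in atTop, ‖transferAvg T Q n f x - ψ x‖ < 2 * c} ≤
        ENNReal.ofReal ((∫ x, ‖(transferAvg T Q N f - ψ) x‖ ∂μ) / c) := by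
      intro N hN0
      refine (measure_mono_ae ?_).trans (measure_exists_birkhoffSum_gt_le hT
        ((hAm N).sub hψm).norm.measurable ((hAL N).integrable (by norm_num)).norm
        (fun _ => norm_nonneg _) hc)
      filter_upwards [hfix] with x hx hbadx
      by_contra hno
      refine hbadx ?_
      have hno' : ∀ n : ℕ, birkhoffSum T (fun y => ‖(transferAvg T Q N f - ψ) y‖) n x ≤ n * c := by
        intro n
        by_contra! hcon
        exact hno ⟨n, hcon⟩
      have ht := (tendsto_transferAvg_sub_transferAvg (T := T) hQ hf hN0 x).norm
      rw [norm_zero] at ht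
      filter_upwards [ht.eventually (gt_mem_nhds hc), eventually_gt_atTop 0] with n hn hn0
      have hψn : transferAvg T Q n ψ x = ψ x := by
        rw [transferAvg, Finset.sum_congr rfl fun k _ => hx k, Finset.sum_const, Finset.card_range,
          ← Nat.cast_smul_eq_nsmul ℝ, smul_smul, inv_mul_cancel₀ (Nat.cast_ne_zero.2 hn0.ne'),
          one_smul]
      have h3 : ‖transferAvg T Q n (transferAvg T Q N f) x - ψ x‖ ≤ c := by
        rw [← hψn, ← transferAvg_sub]
        refine (norm_transferAvg_le hQ n _ x).trans ?_
        rw [inv_mul_le_iff₀ (Nat.cast_pos.2 hn0)]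
        exact hno' n
      calc ‖transferAvg T Q n f x - ψ x‖ = ‖(transferAvg T Q n (transferAvg T Q N f) x - ψ x) -
          (transferAvg T Q n (transferAvg T Q N f) x - transferAvg T Q n f x)‖ := by
            congr 1; abel
        _ ≤ _ := norm_sub_le _ _
        _ < 2 * c := by linarith
    have h0 : Tendsto (fun N => ENNReal.ofReal ((∫ x, ‖(transferAvg T Q N f - ψ) x‖ ∂μ) / c))
        atTop (𝓝 0) := by
      have := ENNReal.tendsto_ofReal (hint.div_const c)
      simpa using this
    exact le_antisymm (ge_of_tendsto h0 ((eventually_ne_atTop 0).mono hN)) zero_le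
  have hall : ∀ᵐ x ∂μ, ∀ m : ℕ, ∀ᶠ n in atTop,
      ‖transferAvg T Q n f x - ψ x‖ < 2 * (1 / ((m : ℝ) + 1)) :=
    ae_all_iff.2 fun m => hbad _ Nat.one_div_pos_of_nat
  filter_upwards [hall] with x hx
  rw [tendsto_iff_norm_sub_tendsto_zero, Metric.tendsto_nhds]
  intro ε hε
  obtain ⟨m, hm⟩ := exists_nat_one_div_lt (half_pos hε)
  filter_upwards [hx m] with n hn
  rw [dist_zero_right, norm_norm]
  linarith

end Transfer

/-! ### Iterates of quaternionic cocycles over a rotation -/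

/-- The iterates `Q(x) Q(x + α) ⋯ Q(x + (n - 1)α)`. -/
def quatIter (α : UnitAddCircle) (Q : UnitAddCircle → ℍ[ℝ]) : ℕ → UnitAddCircle → ℍ[ℝ]
  | 0, _ => 1
  | n + 1, x => quatIter α Q n x * Q (x + n • α)

section Iterates

variable {α : UnitAddCircle} {Q Q' : UnitAddCircle → ℍ[ℝ]}

theorem star_mul_self_of_norm {q : ℍ[ℝ]} (h : ‖q‖ = 1) : star q * q = 1 := by
  rw [Quaternion.star_mul_self, Quaternion.normSq_eq_norm_mul_self, h]
  simp

theorem norm_quatIter (hQ : ∀ x, ‖Q x‖ = 1) (n : ℕ) (x : UnitAddCircle) :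
    ‖quatIter α Q n x‖ = 1 := by
  induction n with
  | zero => simp [quatIter]
  | succ n ih => rw [quatIter, norm_mul, ih, hQ, one_mul]

theorem continuous_quatIter (hQ : Continuous Q) (n : ℕ) : Continuous (quatIter α Q n) := by
  induction n with
  | zero => exact continuous_const
  | succ n ih => exact ih.mul (hQ.comp (continuous_id.add continuous_const))

theorem quatIter_add (m n : ℕ) (x : UnitAddCircle) :
    quatIter α Q (m + n) x = quatIter α Q m x * quatIter α Q n (x + m • α) := by
  induction n with
  | zero => simp [quatIter]
  | succ n ih =>
    rw [← add_assoc, quatIter, ih, quatIter, mul_assoc, add_nsmul, add_assoc]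

/-- Powers of the operator conjugate by the iterates of the cocycle; through this, invariance of `ψ`
becomes a relation between the iterates and values of `ψ`. -/
theorem transfer_iterate_apply (g : UnitAddCircle → ℍ[ℝ]) (k : ℕ) (x : UnitAddCircle) :
    (transfer (· + α) Q)^[k] g x =
      quatIter α Q k x * g (x + k • α) * star (quatIter α Q k x) := by
  induction k generalizing g with
  | zero => simp [quatIter]
  | succ k ih =>
    rw [Function.iterate_succ_apply, ih, transfer_apply, quatIter, star_mul, succ_nsmul, add_assoc]
    simp only [mul_assoc]

theorem continuous_transferAvg (hQ : Continuous Q) {g : UnitAddCircle → ℍ[ℝ]} (hg : Continuous g)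
    (n : ℕ) : Continuous (transferAvg (· + α) Q n g) := by
  have h : ∀ k, Continuous ((transfer (· + α) Q)^[k] g) := fun k => by
    have e : (transfer (· + α) Q)^[k] g = fun x =>
        quatIter α Q k x * g (x + k • α) * star (quatIter α Q k x) :=
      funext fun x => transfer_iterate_apply g k x
    rw [e]
    exact ((continuous_quatIter hQ k).mul (hg.comp (continuous_id.add continuous_const))).mul
      (continuous_quatIter hQ k).star
  exact (continuous_finsetSum (Finset.range n) fun k _ => h k).const_smul (n : ℝ)⁻¹

/-- The logarithmic derivative of the iterates is the sum along `transfer`. -/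
theorem hasDerivAt_quatIter (hQ : ∀ x, ‖Q x‖ = 1)
    (hD : ∀ x, HasDerivAt (fun t : ℝ => Q (x + (t : UnitAddCircle))) (Q' x) 0) (n : ℕ)
    (x : UnitAddCircle) :
    HasDerivAt (fun t : ℝ => quatIter α Q n (x + (t : UnitAddCircle)))
      (n • transferAvg (· + α) Q n (fun y => Q' y * star (Q y)) x * quatIter α Q n x) 0 := by
  have e : ∀ n : ℕ, n • transferAvg (· + α) Q n (fun y => Q' y * star (Q y)) x =
      ∑ k ∈ Finset.range n, (transfer (· + α) Q)^[k] (fun y => Q' y * star (Q y)) x := by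
    intro n
    rcases Nat.eq_zero_or_pos n with rfl | hn
    · simp
    · rw [transferAvg, ← Nat.cast_smul_eq_nsmul ℝ, smul_smul,
        mul_inv_cancel₀ (Nat.cast_ne_zero.2 hn.ne'), one_smul]
  rw [e]
  induction n with
  | zero => simpa [quatIter] using hasDerivAt_const (0 : ℝ) (1 : ℍ[ℝ])
  | succ n ih =>
    have h1 : HasDerivAt (fun t : ℝ => Q (x + (t : UnitAddCircle) + n • α)) (Q' (x + n • α)) 0 := by
      refine (hD (x + n • α)).congr_of_eventuallyEq (Eventually.of_forall fun t => ?_)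
      simp only
      rw [add_right_comm]
    have h2 := ih.mul h1
    refine h2.congr_deriv ?_
    simp only [AddCircle.coe_zero, add_zero]
    rw [Finset.sum_range_succ, transfer_iterate_apply, quatIter, add_mul, mul_assoc]
    congr 1
    have h3 := star_mul_self_of_norm (norm_quatIter (α := α) hQ n x)
    have h4 := star_mul_self_of_norm (hQ (x + n • α))
    calc quatIter α Q n x * Q' (x + n • α)
        = quatIter α Q n x * Q' (x + n • α) * (star (Q (x + n • α)) * 1 * Q (x + n • α)) := by
          rw [mul_one, h4, mul_one]
      _ = _ := by rw [← h3]; simp only [mul_assoc]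

theorem hasDerivAt_quatIter' (hQ : ∀ x, ‖Q x‖ = 1)
    (hD : ∀ x, HasDerivAt (fun t : ℝ => Q (x + (t : UnitAddCircle))) (Q' x) 0) (n : ℕ)
    (x : UnitAddCircle) (s : ℝ) :
    HasDerivAt (fun t : ℝ => quatIter α Q n (x + (t : UnitAddCircle)))
      (n • transferAvg (· + α) Q n (fun y => Q' y * star (Q y)) (x + (s : UnitAddCircle)) *
        quatIter α Q n (x + (s : UnitAddCircle))) s := by
  have h := hasDerivAt_quatIter (α := α) hQ hD n (x + (s : UnitAddCircle))
  rw [← sub_self s] at h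
  refine (h.comp_sub_const s s).congr_of_eventuallyEq (Eventually.of_forall fun t => ?_)
  simp only
  rw [add_assoc, ← AddCircle.coe_add]
  congr 3
  ring

/-- If the averaged logarithmic derivative is close to `p` on an orbit segment of the translation
flow, then the iterate is close to a one-parameter subgroup generated by `p`. -/
theorem enorm_quatIter_sub_rot_le (hQ : ∀ x, ‖Q x‖ = 1) (hQc : Continuous Q) (hQ'c : Continuous Q')
    (hD : ∀ x, HasDerivAt (fun t : ℝ => Q (x + (t : UnitAddCircle))) (Q' x) 0) (n : ℕ)
    (x : UnitAddCircle) (θ : ℝ) {d : ℝ} (hd : d ≠ 0) {p : ℍ[ℝ]} (hp : p.re = 0) (hpd : ‖p‖ = d) :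
    ‖quatIter α Q n (x + (θ : UnitAddCircle)) - rot d (n * θ) p * quatIter α Q n x‖ₑ ≤
      n * ∫⁻ s in Set.uIoc 0 θ,
        ‖transferAvg (· + α) Q n (fun y => Q' y * star (Q y)) (x + (s : UnitAddCircle)) - p‖ₑ := by
  set A := transferAvg (· + α) Q n (fun y => Q' y * star (Q y)) with hA
  have hAc : Continuous A := continuous_transferAvg hQc (hQ'c.mul hQc.star) n
  set β : ℝ → ℍ[ℝ] := fun t => quatIter α Q n (x + (t : UnitAddCircle)) with hβ
  have hcoe : Continuous fun t : ℝ => x + (t : UnitAddCircle) :=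
    continuous_const.add (AddCircle.continuous_mk' 1)
  have hβc : Continuous β := (continuous_quatIter hQc n).comp hcoe
  have hrc : Continuous fun s : ℝ => rot d (-n * s) p :=
    continuous_iff_continuousAt.2 fun s => (hasDerivAt_rot (-n) s hd hp hpd).continuousAt
  -- The integrating factor `exp(-nsp)` cancels the main term, leaving a derivative of norm `n ‖A -
  -- p‖`.
  have hder : ∀ s, HasDerivAt (fun t => rot d (-n * t) p * β t)
      ((n : ℝ) • (rot d (-n * s) p * (A (x + (s : UnitAddCircle)) - p) * β s)) s := by
    intro s
    have h := (hasDerivAt_rot (-n) s hd hp hpd).mul (hasDerivAt_quatIter' (α := α) hQ hD n x s)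
    refine h.congr_deriv ?_
    rw [← Nat.cast_smul_eq_nsmul ℝ, smul_mul_assoc, smul_mul_assoc, mul_smul_comm, neg_smul,
      ← hA, mul_sub, sub_mul, smul_sub]
    simp only [mul_assoc, hβ]
    abel
  have hint := intervalIntegral.integral_eq_sub_of_hasDerivAt (a := 0) (b := θ)
    (fun s _ => hder s) (Continuous.intervalIntegrable
      (((hrc.mul ((hAc.comp hcoe).sub continuous_const)).mul hβc).const_smul (n : ℝ)) _ _)
  have e : rot d (n * θ) p * (rot d (-n * θ) p * β θ - rot d (-n * 0) p * β 0) =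
      quatIter α Q n (x + (θ : UnitAddCircle)) - rot d (n * θ) p * quatIter α Q n x := by
    rw [mul_sub, ← mul_assoc, ← mul_assoc, ← rot_add _ _ hd hp hpd, ← rot_add _ _ hd hp hpd]
    simp [hβ, rot_zero]
  rw [← e, enorm_mul, ← hint, ← ofReal_norm, norm_rot _ hd hp hpd, ENNReal.ofReal_one, one_mul,
    ← ofReal_norm, intervalIntegral.norm_intervalIntegral_eq, ofReal_norm,
    ← lintegral_const_mul' _ _ (ENNReal.natCast_ne_top n)]
  refine (enorm_integral_le_lintegral_enorm _).trans (lintegral_mono fun s => le_of_eq ?_)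
  rw [enorm_smul, enorm_mul, enorm_mul, ← ofReal_norm (rot _ _ _), norm_rot _ hd hp hpd,
    ← ofReal_norm (β s), norm_quatIter hQ]
  simp

end Iterates

/-! ### Integrality of the degree -/

/-- The algebra behind the integrality of the degree: `a`, `b` are two iterates at a point, `a'`,
`b'` the same iterates at nearby points, related by the cocycle identity `a b' = b a'`. -/
theorem one_sub_cos_le {d u v : ℝ} {a b a' b' p p₁ p₂ : ℍ[ℝ]} (hd : 0 < d)
    (hp : p.re = 0) (hpd : ‖p‖ = d) (ha : ‖a‖ = 1) (hb : ‖b‖ = 1)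
    (hab : a * b' = b * a') (h1 : a * p₁ = p * a) (h2 : b * p₂ = p * b) (huv : |u - v| = 1) :
    1 - Real.cos d ≤ ‖b' - rot d u p₁ * b‖ + ‖a' - rot d v p₂ * a‖ +
      1 / d * (‖p₁ - p‖ + ‖p₂ - p‖) := by
  have hrot : ∀ (w : ℝ) (c p₁ : ℍ[ℝ]), c * p₁ = p * c → c * rot d w p₁ = rot d w p * c := by
    intro w c p₁ h
    rw [rot, rot, mul_add, add_mul, mul_smul_comm, h, smul_mul_assoc, Quaternion.mul_coe_eq_smul,
      Quaternion.coe_mul_eq_smul]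
  have e1 : rot d u p * (a * b) - rot d v p * (b * a) =
      b * (a' - rot d v p₂ * a) - a * (b' - rot d u p₁ * b) := by
    rw [mul_sub, mul_sub, ← mul_assoc b, ← mul_assoc a (rot _ _ _), hrot u a p₁ h1,
      hrot v b p₂ h2, hab]
    simp only [mul_assoc]
    abel
  have e2 : rot d v p * ((rot d (u - v) p - 1) * (a * b)) =
      (rot d u p * (a * b) - rot d v p * (b * a)) - rot d v p * (a * b - b * a) := by
    rw [← mul_assoc, mul_sub, ← rot_add _ _ hd.ne' hp hpd, sub_mul, mul_sub, mul_one]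
    rw [add_sub_cancel]
    abel
  have hc : ∀ (c p₁ : ℍ[ℝ]), ‖c‖ = 1 → c * p₁ = p * c → ‖c * p - p * c‖ = ‖p₁ - p‖ := by
    intro c p₁ hc h
    rw [← h, ← mul_sub, norm_mul, hc, one_mul, norm_sub_rev]
  have hcomm := norm_commutator_le hd hp hpd ha hb
  rw [hc a p₁ ha h1, hc b p₂ hb h2] at hcomm
  have hn : ‖rot d (u - v) p - 1‖ ≤ ‖a' - rot d v p₂ * a‖ + ‖b' - rot d u p₁ * b‖ +
      ‖a * b - b * a‖ := by
    have := congrArg norm e2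
    rw [norm_mul, norm_mul, norm_mul, ha, hb, norm_rot _ hd.ne' hp hpd, one_mul, mul_one,
      mul_one, e1] at this
    rw [this]
    refine (norm_sub_le _ _).trans (add_le_add ((norm_sub_le _ _).trans ?_) ?_)
    · rw [norm_mul, norm_mul, ha, hb, one_mul, one_mul]
    · rw [norm_mul, norm_rot _ hd.ne' hp hpd, one_mul]
  -- The real part of `exp(±p) - 1` is `cos d - 1`, whichever the sign.
  have hre := abs_re_le_norm (rot d (u - v) p - 1)
  have hcos : Real.cos ((u - v) * d) = Real.cos d := by
    rcases (abs_eq zero_le_one).1 huv with h | h <;> rw [h] <;> simp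
  have hre' : (rot d (u - v) p - 1).re = Real.cos d - 1 := by
    simp [rot, hp, hcos]
  rw [hre'] at hre
  have := neg_le_abs (Real.cos d - 1)
  linarith

/-- Translations act continuously on `L¹`. -/
theorem tendsto_lintegral_enorm_translate_sub {ψ : UnitAddCircle → ℍ[ℝ]}
    (hψ : MemLp ψ 1 (volume : Measure UnitAddCircle)) :
    Tendsto (fun t : UnitAddCircle => ∫⁻ x, ‖ψ (x + t) - ψ x‖ₑ) (𝓝 0) (𝓝 0) := by
  let g : UnitAddCircle → C(UnitAddCircle, UnitAddCircle) :=
    fun t => ⟨fun x => x + t, continuous_id.add continuous_const⟩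
  have hg : Continuous g := ContinuousMap.continuous_of_continuous_uncurry _
    (continuous_snd.add continuous_fst)
  have hgm : ∀ t, MeasurePreserving (g t) (volume : Measure UnitAddCircle) volume :=
    fun t => measurePreserving_add_right _ t
  have h := (Continuous.compMeasurePreservingLp (f := fun _ => hψ.toLp ψ) continuous_const hg hgm
    ENNReal.one_ne_top).tendsto 0
  rw [tendsto_iff_edist_tendsto_0] at h
  refine h.congr fun t => ?_
  rw [Lp.toLp_compMeasurePreserving, Lp.toLp_compMeasurePreserving, Lp.edist_toLp_toLp,
    eLpNorm_one_eq_lintegral_enorm]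
  simp [g]

/-- The accumulated error along translation segments of length `|θ|`. -/
theorem lintegral_segment_le {A ψ : UnitAddCircle → ℍ[ℝ]} (hA : StronglyMeasurable A)
    (hψ : StronglyMeasurable ψ) (θ : ℝ) {ε : ℝ≥0∞}
    (hε : ∫⁻ x, ‖A x - ψ x‖ₑ ≤ ε)
    (hω : ∀ t : ℝ, |t| ≤ |θ| → ∫⁻ x, ‖ψ (x + (t : UnitAddCircle)) - ψ x‖ₑ ≤ ε) :
    ∫⁻ x, ∫⁻ s in Set.uIoc 0 θ, ‖A (x + (s : UnitAddCircle)) - ψ (x + (θ : UnitAddCircle))‖ₑ ≤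
      ENNReal.ofReal |θ| * (2 * ε) := by
  have hcoe : Measurable fun t : ℝ => (t : UnitAddCircle) :=
    (AddCircle.continuous_mk' 1).measurable
  have hm : Measurable (Function.uncurry fun (x : UnitAddCircle) (s : ℝ) =>
      ‖A (x + (s : UnitAddCircle)) - ψ (x + (θ : UnitAddCircle))‖ₑ) :=
    ((hA.comp_measurable (measurable_fst.add (hcoe.comp measurable_snd))).sub
      (hψ.comp_measurable (measurable_fst.add_const _))).enorm
  rw [lintegral_lintegral_swap hm.aemeasurable]
  -- After Fubini, compare with `ψ(x + s)` at fixed `s`: one term is a translate of `A - ψ`, the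
  -- other a translation error with displacement `θ - s`, and `|θ - s| ≤ |θ|`.
  have hb : ∀ s ∈ Set.uIoc 0 θ,
      ∫⁻ x, ‖A (x + (s : UnitAddCircle)) - ψ (x + (θ : UnitAddCircle))‖ₑ ≤ 2 * ε := by
    intro s hs
    have hst : |θ - s| ≤ |θ| := by
      rcases Set.mem_uIoc.1 hs with ⟨h1, h2⟩ | ⟨h1, h2⟩
      · rw [abs_of_nonneg (by linarith), abs_of_nonneg (by linarith)]; linarith
      · rw [abs_of_nonpos (by linarith), abs_of_nonpos (by linarith)]; linarith
    have h1 : ∫⁻ x, ‖A (x + (s : UnitAddCircle)) - ψ (x + (s : UnitAddCircle))‖ₑ ≤ ε := by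
      rw [lintegral_add_right_eq_self (fun x => ‖A x - ψ x‖ₑ)]
      exact hε
    have h2 : ∫⁻ x, ‖ψ (x + (θ : UnitAddCircle)) - ψ (x + (s : UnitAddCircle))‖ₑ ≤ ε := by
      refine le_trans (le_of_eq ?_) (hω _ hst)
      rw [← lintegral_add_right_eq_self (fun x => ‖ψ (x + ((θ - s : ℝ) : UnitAddCircle)) - ψ x‖ₑ)
        (s : UnitAddCircle)]
      refine lintegral_congr fun x => ?_
      rw [add_assoc, ← AddCircle.coe_add, add_sub_cancel]
    calc ∫⁻ x, ‖A (x + (s : UnitAddCircle)) - ψ (x + (θ : UnitAddCircle))‖ₑ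
        ≤ ∫⁻ x, (‖A (x + (s : UnitAddCircle)) - ψ (x + (s : UnitAddCircle))‖ₑ +
          ‖ψ (x + (θ : UnitAddCircle)) - ψ (x + (s : UnitAddCircle))‖ₑ) := by
          refine lintegral_mono fun x => ?_
          refine le_trans (le_of_eq ?_) (enorm_sub_le (a := A (x + (s : UnitAddCircle)) -
            ψ (x + (s : UnitAddCircle))) (b := ψ (x + (θ : UnitAddCircle)) -
              ψ (x + (s : UnitAddCircle))))
          congr 1
          abel
      _ = _ := lintegral_add_left ((hA.comp_measurable (measurable_id.add_const _)).sub
          (hψ.comp_measurable (measurable_id.add_const _))).enorm _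
      _ ≤ 2 * ε := by rw [two_mul]; exact add_le_add h1 h2
  calc ∫⁻ s in Set.uIoc 0 θ, ∫⁻ x, ‖A (x + (s : UnitAddCircle)) - ψ (x + (θ : UnitAddCircle))‖ₑ
      ≤ ∫⁻ _ in Set.uIoc 0 θ, 2 * ε := setLIntegral_mono measurable_const hb
    _ = ENNReal.ofReal |θ| * (2 * ε) := by
      rw [setLIntegral_const, mul_comm, Set.uIoc, Real.volume_Ioc, max_sub_min_eq_abs, sub_zero]

/-! ### Continued fraction convergents of the golden rotation -/

section Golden

variable {α : ℝ}

/-- Both sides satisfy the Fibonacci recursion, because `-α` is a root of `x² = x + 1`. The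
displacements thus alternate in sign and decay geometrically. -/
theorem fib_mul_sub_fib (hα : α ^ 2 + α = 1) (n : ℕ) :
    (Nat.fib (n + 1) : ℝ) * α - Nat.fib n = -(-α) ^ (n + 1) := by
  induction n using Nat.twoStepInduction with
  | zero => simp
  | one =>
    simp
    linarith
  | more n h1 h2 =>
    rw [Nat.fib_add_two (n := n + 1), Nat.fib_add_two (n := n)]
    push_cast
    have e : -(-α) ^ (n + 2 + 1) = -(-α) ^ (n + 1) + -(-α) ^ (n + 1 + 1) := by
      rw [pow_succ _ (n + 2), pow_succ _ (n + 1)]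
      linear_combination (-(-α) ^ (n + 1)) * hα
    rw [e, ← h1, ← h2, Nat.fib_add_two (n := n)]
    push_cast
    ring

/-- Passing from `n` to `n + 1` uses only `α(1 + α) = 1`. The two positive summands are products of
a denominator with the adjacent displacement: their sum yields the determinant `±1`, and each alone
is at most `1`. -/
theorem pow_mul_fib_add (hα : α ^ 2 + α = 1) (n : ℕ) :
    α ^ (n + 1) * (Nat.fib (n + 2) + α * Nat.fib (n + 1)) = 1 := by
  induction n with
  | zero =>
    simp
    linarith
  | succ n ih =>
    rw [Nat.fib_add_two (n := n + 1)]
    push_cast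
    rw [← ih, pow_succ _ (n + 1)]
    linear_combination α ^ (n + 1) * (Nat.fib (n + 1 + 1) : ℝ) * hα

/-- Irrationality of `α`, in the form that ergodicity of the rotation requires. -/
theorem addOrderOf_golden (hα_pos : 0 < α) (hα : α ^ 2 + α = 1) :
    addOrderOf (α : UnitAddCircle) = 0 := by
  have hirr : Irrational α := by
    have e : α = -Real.goldenConj := by
      have h1 := Real.goldenConj_sq
      have h2 := Real.goldenConj_neg
      nlinarith
    rw [e]
    exact Real.goldenConj_irrational.neg
  rw [addOrderOf_eq_zero_iff']
  intro n hn h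
  rw [← AddCircle.coe_nsmul, AddCircle.coe_eq_zero_iff] at h
  obtain ⟨m, hm⟩ := h
  refine (hirr.natCast_mul hn.ne').ne_int m ?_
  simpa using hm.symm

end Golden

/-! ### The degree of a quaternionic cocycle -/

instance isProbabilityMeasure_unitAddCircle :
    IsProbabilityMeasure (volume : Measure UnitAddCircle) :=
  ⟨UnitAddCircle.measure_univ⟩

section Degree

variable {Q Q' : UnitAddCircle → ℍ[ℝ]}

/-- Differentiate `‖Q‖² = 1`. -/
theorem re_mul_star_eq_zero (hQ : ∀ x, ‖Q x‖ = 1)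
    (hD : ∀ x, HasDerivAt (fun t : ℝ => Q (x + (t : UnitAddCircle))) (Q' x) 0)
    (x : UnitAddCircle) : (Q' x * star (Q x)).re = 0 := by
  have h := (hD x).norm_sq
  have hc : (fun t : ℝ => ‖Q (x + (t : UnitAddCircle))‖) ^ 2 = fun _ => (1 : ℝ) := by
    ext1 t
    simp [hQ]
  have h0 := (h.congr_of_eventuallyEq (f₁ := fun _ => (1 : ℝ))
    (Eventually.of_forall fun t => (congrFun hc t).symm)).unique (hasDerivAt_const _ _)
  rw [AddCircle.coe_zero, add_zero, real_inner_comm, Quaternion.inner_def] at h0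
  linarith

theorem re_transferAvg {α : UnitAddCircle} {f : UnitAddCircle → ℍ[ℝ]} (hf : ∀ x, (f x).re = 0)
    (n : ℕ) (x : UnitAddCircle) : (transferAvg (· + α) Q n f x).re = 0 := by
  have h : ∀ s : Finset ℕ, (∑ k ∈ s, (transfer (· + α) Q)^[k] f x).re = 0 := by
    intro s
    induction s using Finset.induction_on with
    | empty => simp
    | insert a s ha ih =>
      rw [Finset.sum_insert ha, Quaternion.re_add, ih, transfer_iterate_apply, add_zero]
      have := hf (x + a • α)
      simp [this]
      ring
  rw [transferAvg, Quaternion.re_smul, h, smul_zero]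

/-- Existence of the limit of the averaged logarithmic derivatives over an ergodic rotation. -/
theorem exists_transferAvg_limit {α : UnitAddCircle} (hα : addOrderOf α = 0)
    (hQc : Continuous Q) (hQ : ∀ x, ‖Q x‖ = 1) {f : UnitAddCircle → ℍ[ℝ]} (hf : Continuous f)
    (hre : ∀ x, (f x).re = 0) :
    ∃ (ψ : UnitAddCircle → ℍ[ℝ]) (d : ℝ), (∀ x, (ψ x).re = 0) ∧ StronglyMeasurable ψ ∧
      MemLp ψ 2 (volume : Measure UnitAddCircle) ∧ transfer (· + α) Q ψ =ᵐ[volume] ψ ∧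
      Tendsto (fun n => eLpNorm (transferAvg (· + α) Q n f - ψ) 2 volume) atTop (𝓝 0) ∧
      (∀ᵐ x, Tendsto (fun n => transferAvg (· + α) Q n f x) atTop (𝓝 (ψ x))) ∧
      ∀ᵐ x, ‖ψ x‖ = d := by
  have hT : MeasurePreserving (· + α) (volume : Measure UnitAddCircle) volume :=
    measurePreserving_add_right _ α
  have hQm := hQc.stronglyMeasurable
  obtain ⟨C, hC⟩ := isCompact_univ.exists_bound_of_continuousOn hf.continuousOn
  have hfC : ∀ x, ‖f x‖ ≤ C := fun x => hC x (Set.mem_univ x)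
  have hfL : MemLp f 2 (volume : Measure UnitAddCircle) :=
    MemLp.of_bound hf.aestronglyMeasurable C (ae_of_all _ hfC)
  obtain ⟨ψ, hψm, hψL, hinv, hlim⟩ := exists_tendsto_eLpNorm_transferAvg hT hQm hQ hfL
  have hae := ae_tendsto_transferAvg hT hQm hQ hf.stronglyMeasurable hfC hψm hψL hinv hlim
  -- The limit is imaginary only almost everywhere; taking imaginary parts gives a representative
  -- that is imaginary at every point.
  have him : (fun x => (ψ x).im) =ᵐ[volume] ψ := by
    filter_upwards [hae] with x hx
    have h := (Quaternion.continuous_re.tendsto _).comp hx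
    have h0 : (ψ x).re = 0 := tendsto_nhds_unique h
      (tendsto_const_nhds.congr fun n => (re_transferAvg hre n x).symm)
    ext <;> simp [h0]
  have hinv' : transfer (· + α) Q (fun x => (ψ x).im) =ᵐ[volume] fun x => (ψ x).im :=
    (transfer_congr_ae hT him).trans (hinv.trans him.symm)
  have hm' : StronglyMeasurable fun x => (ψ x).im :=
    Quaternion.continuous_im.comp_stronglyMeasurable hψm
  have herg : Ergodic (· + α) (volume : Measure UnitAddCircle) :=
    AddCircle.ergodic_add_right.2 hα
  obtain ⟨d, hd⟩ := herg.ae_eq_const_of_ae_eq_comp_ae hm'.norm.aestronglyMeasurable (by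
    filter_upwards [hinv'] with x hx
    have := norm_transfer_iterate (T := (· + α)) hQ 1 (fun x => (ψ x).im) x
    rw [Function.iterate_one, hx] at this
    exact this.symm)
  refine ⟨fun x => (ψ x).im, d, fun x => by simp, hm', (memLp_congr_ae him).2 hψL, hinv',
    hlim.congr fun n => eLpNorm_congr_ae (EventuallyEq.rfl.sub him.symm), ?_, hd⟩
  filter_upwards [hae, him] with x h1 h2
  rwa [h2]

/-! ### Comparison of two return times -/

section Segments

variable {α : UnitAddCircle} {ψ : UnitAddCircle → ℍ[ℝ]} {d : ℝ}

theorem ofReal_le_enorm_add {E : Type*} [SeminormedAddCommGroup E] {a b e f : E} {c r : ℝ}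
    (h : c ≤ ‖a‖ + ‖b‖ + r * (‖e‖ + ‖f‖)) (hr : 0 ≤ r) :
    ENNReal.ofReal c ≤ ‖a‖ₑ + ‖b‖ₑ + ENNReal.ofReal r * (‖e‖ₑ + ‖f‖ₑ) := by
  refine (ENNReal.ofReal_le_ofReal h).trans (le_of_eq ?_)
  rw [ENNReal.ofReal_add (by positivity) (by positivity),
    ENNReal.ofReal_add (norm_nonneg _) (norm_nonneg _), ENNReal.ofReal_mul hr,
    ENNReal.ofReal_add (norm_nonneg _) (norm_nonneg _), ofReal_norm, ofReal_norm, ofReal_norm,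
    ofReal_norm]

theorem ae_translate {p : UnitAddCircle → Prop} (h : ∀ᵐ x, p x) (t : UnitAddCircle) :
    ∀ᵐ x, p (x + t) := by
  have hT : MeasurePreserving (· + t) (volume : Measure UnitAddCircle) volume :=
    measurePreserving_add_right _ t
  exact hT.quasiMeasurePreserving.tendsto_ae.eventually h

/-- Two return times `m`, `m'` of the rotation whose return displacements `θ`, `θ'` satisfy
`m' θ - m θ' = ±1` force `d` to be close to `2πℤ`. -/
theorem ae_one_sub_cos_le (hQ : ∀ x, ‖Q x‖ = 1) (hQc : Continuous Q) (hQ'c : Continuous Q')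
    (hD : ∀ x, HasDerivAt (fun t : ℝ => Q (x + (t : UnitAddCircle))) (Q' x) 0)
    (hd : 0 < d) (hre : ∀ x, (ψ x).re = 0) (hinv : transfer (· + α) Q ψ =ᵐ[volume] ψ)
    (hψd : ∀ᵐ x, ‖ψ x‖ = d) {m m' : ℕ} {θ θ' : ℝ} (hθ : (θ : UnitAddCircle) = m • α)
    (hθ' : (θ' : UnitAddCircle) = m' • α) (hdet : |m' * θ - m * θ'| = 1) :
    ∀ᵐ x, ENNReal.ofReal (1 - Real.cos d) ≤
      (m' * ∫⁻ s in Set.uIoc 0 θ, ‖transferAvg (· + α) Q m' (fun y => Q' y * star (Q y))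
        (x + (s : UnitAddCircle)) - ψ (x + (θ : UnitAddCircle))‖ₑ) +
      (m * ∫⁻ s in Set.uIoc 0 θ', ‖transferAvg (· + α) Q m (fun y => Q' y * star (Q y))
        (x + (s : UnitAddCircle)) - ψ (x + (θ' : UnitAddCircle))‖ₑ) +
      ENNReal.ofReal (1 / d) * (‖ψ (x + (θ : UnitAddCircle)) - ψ x‖ₑ +
        ‖ψ (x + (θ' : UnitAddCircle)) - ψ x‖ₑ) := by
  have hfix : ∀ᵐ x, ∀ k, (transfer (· + α) Q)^[k] ψ x = ψ x :=
    ae_all_iff.2 fun k => transfer_iterate_fixed_ae (measurePreserving_add_right _ _) hinv k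
  have hψd' : ∀ t : ℝ, ∀ᵐ x, ‖ψ (x + (t : UnitAddCircle))‖ = d := fun t =>
    ae_translate hψd t
  filter_upwards [hfix, hψd, hψd' θ, hψd' θ'] with x hx hx0 hx1 hx2
  have hcomm : ∀ (k : ℕ) (t : ℝ), (t : UnitAddCircle) = k • α →
      quatIter α Q k x * ψ (x + (t : UnitAddCircle)) = ψ x * quatIter α Q k x := by
    intro k t ht
    have h := hx k
    rw [transfer_iterate_apply] at h
    rw [← h, mul_assoc _ (star _), star_mul_self_of_norm (norm_quatIter hQ _ _), mul_one, ht]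
  have hab : quatIter α Q m x * quatIter α Q m' (x + (θ : UnitAddCircle)) =
      quatIter α Q m' x * quatIter α Q m (x + (θ' : UnitAddCircle)) := by
    rw [hθ, hθ', ← quatIter_add, ← quatIter_add, add_comm]
  -- The iterates are compared with exponentials of `ψ` at the endpoints `x + θ` and `x + θ'`, not
  -- at `x`, because those values are the exact conjugates of `ψ(x)`.
  have hmain := one_sub_cos_le hd (hre x) hx0 (norm_quatIter hQ m x)
    (norm_quatIter hQ m' x) hab (hcomm m θ hθ) (hcomm m' θ' hθ') hdet
  exact (ofReal_le_enorm_add hmain (one_div_nonneg.2 hd.le)).trans (add_le_add (add_le_add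
    (enorm_quatIter_sub_rot_le hQ hQc hQ'c hD m' x θ hd.ne' (hre _) hx1)
    (enorm_quatIter_sub_rot_le hQ hQc hQ'c hD m x θ' hd.ne' (hre _) hx2)) le_rfl)

theorem measurable_segment {A : UnitAddCircle → ℍ[ℝ]} (hA : StronglyMeasurable A)
    (hψ : StronglyMeasurable ψ) (t : ℝ) : Measurable fun x : UnitAddCircle =>
      ∫⁻ s in Set.uIoc 0 t, ‖A (x + (s : UnitAddCircle)) - ψ (x + (t : UnitAddCircle))‖ₑ := by
  have hcoe : Measurable fun t : ℝ => (t : UnitAddCircle) :=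
    (AddCircle.continuous_mk' 1).measurable
  exact Measurable.lintegral_prod_right' (f := fun z : UnitAddCircle × ℝ =>
    ‖A (z.1 + (z.2 : UnitAddCircle)) - ψ (z.1 + (t : UnitAddCircle))‖ₑ)
    ((hA.comp_measurable (measurable_fst.add (hcoe.comp measurable_snd))).sub
      (hψ.comp_measurable (measurable_fst.add_const _))).enorm

/-- The growth of the derivative, of order `m`, is compensated by the segment length `|θ| ≤ 1/m`, so
the error stays comparable to `ε`. -/
theorem natCast_mul_lintegral_segment_le {A : UnitAddCircle → ℍ[ℝ]} (hA : StronglyMeasurable A)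
    (hψ : StronglyMeasurable ψ) {m : ℕ} {θ : ℝ} (hm : m * |θ| ≤ 1) {ε : ℝ≥0∞}
    (hε : ∫⁻ x, ‖A x - ψ x‖ₑ ≤ ε)
    (hω : ∀ t : ℝ, |t| ≤ |θ| → ∫⁻ x, ‖ψ (x + (t : UnitAddCircle)) - ψ x‖ₑ ≤ ε) :
    m * (∫⁻ x, ∫⁻ s in Set.uIoc 0 θ,
      ‖A (x + (s : UnitAddCircle)) - ψ (x + (θ : UnitAddCircle))‖ₑ) ≤ 2 * ε := by
  calc _ ≤ (m : ℝ≥0∞) * (ENNReal.ofReal |θ| * (2 * ε)) :=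
        mul_le_mul_right (lintegral_segment_le hA hψ θ hε hω) _
    _ = ENNReal.ofReal (m * |θ|) * (2 * ε) := by
        rw [← mul_assoc, ENNReal.ofReal_mul (Nat.cast_nonneg m), ENNReal.ofReal_natCast]
    _ ≤ 1 * (2 * ε) := mul_le_mul_left (ENNReal.ofReal_le_one.2 hm) _
    _ = 2 * ε := one_mul _

/-- Integrate the pointwise estimate over the circle: each segment costs `2ε`, and each comparison
of `ψ` with a translate costs `ε`, weighted by `1/d`. -/
theorem ofReal_one_sub_cos_le (hQ : ∀ x, ‖Q x‖ = 1) (hQc : Continuous Q) (hQ'c : Continuous Q')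
    (hD : ∀ x, HasDerivAt (fun t : ℝ => Q (x + (t : UnitAddCircle))) (Q' x) 0)
    (hd : 0 < d) (hre : ∀ x, (ψ x).re = 0) (hψm : StronglyMeasurable ψ)
    (hinv : transfer (· + α) Q ψ =ᵐ[volume] ψ)
    (hψd : ∀ᵐ x, ‖ψ x‖ = d) {m m' : ℕ} {θ θ' : ℝ} (hθ : (θ : UnitAddCircle) = m • α)
    (hθ' : (θ' : UnitAddCircle) = m' • α) (hdet : |m' * θ - m * θ'| = 1)
    (h1 : m' * |θ| ≤ 1) (h2 : m * |θ'| ≤ 1) {ε : ℝ≥0∞}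
    (hm : ∫⁻ x, ‖transferAvg (· + α) Q m (fun y => Q' y * star (Q y)) x - ψ x‖ₑ ≤ ε)
    (hm' : ∫⁻ x, ‖transferAvg (· + α) Q m' (fun y => Q' y * star (Q y)) x - ψ x‖ₑ ≤ ε)
    (hω : ∀ t : ℝ, |t| ≤ |θ| ∨ |t| ≤ |θ'| →
      ∫⁻ x, ‖ψ (x + (t : UnitAddCircle)) - ψ x‖ₑ ≤ ε) :
    ENNReal.ofReal (1 - Real.cos d) ≤ (4 + ENNReal.ofReal (1 / d) * 2) * ε := by
  have hpt := ae_one_sub_cos_le hQ hQc hQ'c hD hd hre hinv hψd hθ hθ' hdet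
  have hAm : ∀ n, StronglyMeasurable
      (transferAvg (· + α) Q n (fun y => Q' y * star (Q y))) := fun n =>
    (continuous_transferAvg hQc (hQ'c.mul hQc.star) n).stronglyMeasurable
  have hmψ : ∀ t : ℝ, Measurable fun x => ‖ψ (x + (t : UnitAddCircle)) - ψ x‖ₑ := fun t =>
    ((hψm.comp_measurable (measurable_id.add_const _)).sub hψm).enorm
  have hs1 := (measurable_segment (hAm m') hψm θ).const_mul (m' : ℝ≥0∞)
  have hs2 := (measurable_segment (hAm m) hψm θ').const_mul (m : ℝ≥0∞)
  calc ENNReal.ofReal (1 - Real.cos d)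
      = ∫⁻ _ : UnitAddCircle, ENNReal.ofReal (1 - Real.cos d) := by
        rw [lintegral_const, measure_univ, mul_one]
    _ ≤ _ := lintegral_mono_ae hpt
    _ ≤ 2 * ε + 2 * ε + ENNReal.ofReal (1 / d) * (ε + ε) := by
        rw [lintegral_add_left (hs1.fun_add hs2), lintegral_add_left hs1,
          lintegral_const_mul _ (measurable_segment (hAm m') hψm θ),
          lintegral_const_mul _ (measurable_segment (hAm m) hψm θ'),
          lintegral_const_mul _ ((hmψ _).fun_add (hmψ _)), lintegral_add_left (hmψ _)]
        refine add_le_add (add_le_add ?_ ?_) (mul_le_mul_right (add_le_add ?_ ?_) _)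
        · exact natCast_mul_lintegral_segment_le (hAm m') hψm h1 hm' fun t ht => hω t (.inl ht)
        · exact natCast_mul_lintegral_segment_le (hAm m) hψm h2 hm fun t ht => hω t (.inr ht)
        · exact hω _ (.inl le_rfl)
        · exact hω _ (.inr le_rfl)
    _ = _ := by ring

end Segments

/-- Over the golden rotation the norm of the limit is a multiple of `2π`. -/
theorem cos_norm_limit_eq_one {α : ℝ} (hα_pos : 0 < α) (hα : α ^ 2 + α = 1)
    (hQ : ∀ x, ‖Q x‖ = 1) (hQc : Continuous Q) (hQ'c : Continuous Q')
    (hD : ∀ x, HasDerivAt (fun t : ℝ => Q (x + (t : UnitAddCircle))) (Q' x) 0)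
    {ψ : UnitAddCircle → ℍ[ℝ]} {d : ℝ} (hd : 0 < d) (hre : ∀ x, (ψ x).re = 0)
    (hψm : StronglyMeasurable ψ) (hψL : MemLp ψ 2 (volume : Measure UnitAddCircle))
    (hinv : transfer (· + (α : UnitAddCircle)) Q ψ =ᵐ[volume] ψ)
    (hlim : Tendsto (fun n => eLpNorm (transferAvg (· + (α : UnitAddCircle)) Q n
      (fun y => Q' y * star (Q y)) - ψ) 2 volume) atTop (𝓝 0))
    (hψd : ∀ᵐ x, ‖ψ x‖ = d) : Real.cos d = 1 := by
  have hL1 : Tendsto (fun n => ∫⁻ x, ‖transferAvg (· + (α : UnitAddCircle)) Q n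
      (fun y => Q' y * star (Q y)) x - ψ x‖ₑ) atTop (𝓝 0) := by
    refine tendsto_of_tendsto_of_tendsto_of_le_of_le tendsto_const_nhds hlim (fun _ => zero_le)
      fun n => ?_
    refine le_trans (le_of_eq ?_) (eLpNorm_le_eLpNorm_of_exponent_le (p := 1) (by norm_num)
      (((continuous_transferAvg hQc (hQ'c.mul hQc.star) n).stronglyMeasurable).sub
        hψm).aestronglyMeasurable)
    rw [eLpNorm_one_eq_lintegral_enorm]
    rfl
  have hω : Tendsto (fun t : ℝ => ∫⁻ x, ‖ψ (x + (t : UnitAddCircle)) - ψ x‖ₑ) (𝓝 0) (𝓝 0) := by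
    have h := (AddCircle.continuous_mk' (1 : ℝ)).tendsto 0
    exact (tendsto_lintegral_enorm_translate_sub (hψL.mono_exponent (by norm_num))).comp h
  have hq : Tendsto (fun n => Nat.fib (n + 1)) atTop atTop := by
    have h : Tendsto Nat.fib atTop atTop := (tendsto_add_atTop_iff_nat 2).1
      Nat.fib_add_two_strictMono.tendsto_atTop
    exact h.comp (tendsto_add_atTop_nat 1)
  -- The convergents of `α` are `Nat.fib n / Nat.fib (n + 1)`; `q` and `θ` are their denominators
  -- and signed displacements.
  set q : ℕ → ℕ := fun n => Nat.fib (n + 1) with hq_def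
  set θ : ℕ → ℝ := fun n => q n * α - Nat.fib n with hθ_def
  have hα1 : α < 1 := by nlinarith
  have hθ : ∀ n, θ n = -(-α) ^ (n + 1) := fun n => fib_mul_sub_fib hα n
  have hθabs : ∀ n, |θ n| = α ^ (n + 1) := fun n => by
    rw [hθ, abs_neg, abs_pow, abs_neg, abs_of_pos hα_pos]
  have hθcoe : ∀ n, (θ n : UnitAddCircle) = q n • (α : UnitAddCircle) := fun n => by
    have h0 : ((Nat.fib n : ℝ) : UnitAddCircle) = 0 :=
      AddCircle.coe_eq_zero_iff _ |>.2 ⟨Nat.fib n, by simp⟩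
    rw [hθ_def, AddCircle.coe_sub, h0, sub_zero, ← nsmul_eq_mul, AddCircle.coe_nsmul]
  have hkey := fun n => pow_mul_fib_add hα n
  have hb1 : ∀ n, q (n + 1) * |θ n| ≤ 1 := fun n => by
    have h := hkey n
    rw [hθabs]
    have : 0 ≤ α ^ (n + 1) * (α * (Nat.fib (n + 1) : ℝ)) := by positivity
    simp only [hq_def]
    linarith
  have hb2 : ∀ n, q n * |θ (n + 1)| ≤ 1 := fun n => by
    have h := hkey n
    rw [hθabs]
    have : 0 ≤ α ^ (n + 1) * (Nat.fib (n + 2) : ℝ) := by positivity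
    simp only [hq_def]
    rw [pow_succ]
    linarith
  have hdet : ∀ n, |q (n + 1) * θ n - q n * θ (n + 1)| = 1 := fun n => by
    have e : q (n + 1) * θ n - q n * θ (n + 1) =
        -((-α) ^ (n + 1) * (Nat.fib (n + 2) + α * Nat.fib (n + 1))) := by
      rw [hθ, hθ, pow_succ _ (n + 1)]
      simp only [hq_def]
      ring
    rw [e, abs_neg, abs_mul, abs_pow, abs_neg, abs_of_pos hα_pos, abs_of_nonneg (by positivity),
      hkey]
  have hθ0 : Tendsto (fun n => α ^ (n + 1)) atTop (𝓝 0) :=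
    (tendsto_pow_atTop_nhds_zero_of_lt_one hα_pos.le hα1).comp (tendsto_add_atTop_nat 1)
  have hbound : ∀ ε : ℝ≥0∞, 0 < ε →
      ENNReal.ofReal (1 - Real.cos d) ≤ (4 + ENNReal.ofReal (1 / d) * 2) * ε := by
    intro ε hε
    obtain ⟨δ, hδ, hδω⟩ := Metric.eventually_nhds_iff.1 (hω.eventually (ge_mem_nhds hε))
    have e1 := (hL1.comp hq).eventually (ge_mem_nhds hε)
    have e2 := (tendsto_add_atTop_nat 1).eventually e1
    -- One `n` serves for both denominators: the averages of orders `q n` and `q (n + 1)` are within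
    -- `ε` of `ψ` in `L¹`, and both displacements are in the range where translation moves `ψ` by at
    -- most `ε`.
    obtain ⟨n, h1, h2, h3⟩ := (e1.and (e2.and (hθ0.eventually (gt_mem_nhds hδ)))).exists
    simp only [Function.comp_apply] at h1 h2
    have hs0 : |θ n| < δ := by rw [hθabs]; exact h3
    have hs1 : |θ (n + 1)| < δ := by
      rw [hθabs]
      exact lt_of_le_of_lt (pow_le_pow_of_le_one hα_pos.le hα1.le (by omega)) h3
    have hω' : ∀ t : ℝ, |t| < δ → ∫⁻ x, ‖ψ (x + (t : UnitAddCircle)) - ψ x‖ₑ ≤ ε :=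
      fun t ht => hδω (by simpa using ht)
    exact ofReal_one_sub_cos_le hQ hQc hQ'c hD hd hre hψm hinv hψd (hθcoe n) (hθcoe (n + 1))
      (hdet n) (hb1 n) (hb2 n) h1 h2 fun t ht => hω' t (ht.elim (·.trans_lt hs0) (·.trans_lt hs1))
  have hK : (4 + ENNReal.ofReal (1 / d) * 2) ≠ ∞ :=
    ENNReal.add_ne_top.2 ⟨by norm_num, ENNReal.mul_ne_top ENNReal.ofReal_ne_top (by norm_num)⟩
  have ht : Tendsto (fun ε : ℝ≥0∞ => (4 + ENNReal.ofReal (1 / d) * 2) * ε) (𝓝[>] 0) (𝓝 0) := by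
    have h := ENNReal.Tendsto.const_mul (a := 4 + ENNReal.ofReal (1 / d) * 2)
      (tendsto_id (x := 𝓝 (0 : ℝ≥0∞))) (Or.inr hK)
    rw [mul_zero] at h
    exact h.mono_left nhdsWithin_le_nhds
  have h0 : ENNReal.ofReal (1 - Real.cos d) ≤ 0 :=
    ge_of_tendsto ht (eventually_nhdsWithin_of_forall fun ε hε => hbound ε hε)
  have h1 := ENNReal.ofReal_eq_zero.1 (le_antisymm h0 zero_le)
  linarith [Real.cos_le_one d]

end Degree

/-! ### Translation to `SU(2)` -/

section Bridge

variable {φ : UnitAddCircle → SU2}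

theorem toQuat_iter (α : UnitAddCircle) (φ : UnitAddCircle → SU2) (n : ℕ) (x : UnitAddCircle) :
    toQuat (iter α φ n x).1 = quatIter α (fun y => toQuat (φ y).1) n x := by
  induction n with
  | zero => exact (congrArg toQuat toMat_one.symm).trans (toQuat_toMat 1)
  | succ n ih => rw [iter, toQuat_mul, ih, quatIter]

/-- The quaternion coordinates of a `C²` cocycle are `C²`. -/
theorem contDiff_toQuat (hφ : IsClassC 2 φ) :
    ContDiff ℝ 2 fun t : ℝ => toQuat (φ (t : UnitAddCircle)).1 := by
  have hre : ∀ i j, ContDiff ℝ 2 fun t : ℝ => ((φ (t : UnitAddCircle)).1 i j).re := fun i j =>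
    Complex.reCLM.contDiff.comp (hφ i j)
  have him : ∀ i j, ContDiff ℝ 2 fun t : ℝ => ((φ (t : UnitAddCircle)).1 i j).im := fun i j =>
    Complex.imCLM.contDiff.comp (hφ i j)
  have e : (fun t : ℝ => toQuat (φ (t : UnitAddCircle)).1) = fun t : ℝ =>
      ((φ (t : UnitAddCircle)).1 0 0).re • (⟨1, 0, 0, 0⟩ : ℍ[ℝ]) +
      ((φ (t : UnitAddCircle)).1 0 0).im • (⟨0, 1, 0, 0⟩ : ℍ[ℝ]) +
      ((φ (t : UnitAddCircle)).1 0 1).re • (⟨0, 0, 1, 0⟩ : ℍ[ℝ]) +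
      ((φ (t : UnitAddCircle)).1 0 1).im • (⟨0, 0, 0, 1⟩ : ℍ[ℝ]) := by
    ext t <;> simp [toQuat]
  rw [e]
  exact ((((hre 0 0).smul contDiff_const).add ((him 0 0).smul contDiff_const)).add
    ((hre 0 1).smul contDiff_const)).add ((him 0 1).smul contDiff_const)

/-- The derivative at a point of the circle is that of the lift at any representative, so continuity
descends through the quotient map. -/
theorem exists_continuous_deriv_of_lift {Q : UnitAddCircle → ℍ[ℝ]}
    (h : ContDiff ℝ 2 fun t : ℝ => Q (t : UnitAddCircle)) :
    Continuous Q ∧ ∃ Q' : UnitAddCircle → ℍ[ℝ], Continuous Q' ∧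
      ∀ x, HasDerivAt (fun t : ℝ => Q (x + (t : UnitAddCircle))) (Q' x) 0 := by
  have hquot : IsQuotientMap ((↑) : ℝ → UnitAddCircle) := QuotientAddGroup.isQuotientMap_mk _
  have hlift : ∀ s : ℝ, HasDerivAt (fun t : ℝ => Q ((s : UnitAddCircle) + (t : UnitAddCircle)))
      (deriv (fun t : ℝ => Q (t : UnitAddCircle)) s) 0 := by
    intro s
    have h1 := (h.differentiable (by norm_num) s).hasDerivAt
    rw [← add_zero s] at h1
    refine ((h1.comp_const_add s 0).congr_of_eventuallyEq
      (Eventually.of_forall fun t => ?_)).congr_deriv (by rw [add_zero])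
    simp only
    rw [AddCircle.coe_add]
  refine ⟨hquot.continuous_iff.2 h.continuous,
    fun x => deriv (fun t : ℝ => Q (x + (t : UnitAddCircle))) 0, hquot.continuous_iff.2 ?_, ?_⟩
  · have e : (fun x => deriv (fun t : ℝ => Q (x + (t : UnitAddCircle))) 0) ∘
        ((↑) : ℝ → UnitAddCircle) = deriv fun t : ℝ => Q (t : UnitAddCircle) :=
      funext fun s => (hlift s).deriv
    rw [e]
    exact h.continuous_deriv (by norm_num)
  · intro x
    obtain ⟨s, rfl⟩ := QuotientAddGroup.mk_surjective x
    exact (hlift s).differentiableAt.hasDerivAt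

theorem logDerivAvg_eq_toMat {α : UnitAddCircle} {Q' : UnitAddCircle → ℍ[ℝ]}
    (hD : ∀ x, HasDerivAt (fun t : ℝ => toQuat (φ (x + (t : UnitAddCircle))).1) (Q' x) 0)
    (n : ℕ) (x : UnitAddCircle) :
    logDerivAvg α φ n x = toMat (transferAvg (· + α) (fun y => toQuat (φ y).1) n
      (fun y => Q' y * star (toQuat (φ y).1)) x) := by
  set Q : UnitAddCircle → ℍ[ℝ] := fun y => toQuat (φ y).1 with hQdef
  have hQ : ∀ x, ‖Q x‖ = 1 := fun x => norm_toQuat _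
  have h := hasDerivAt_quatIter (α := α) hQ hD n x
  set A := transferAvg (· + α) Q n (fun y => Q' y * star (Q y)) x
  have hDer : D (iter α φ n) x = toMat (n • A * quatIter α Q n x) := by
    ext i j
    have h1 := ((toMatEntry i j).hasFDerivAt.comp_hasDerivAt (0 : ℝ) h).deriv
    have e : (fun t : ℝ => (iter α φ n (x + (t : UnitAddCircle))).1 i j) =
        toMatEntry i j ∘ fun t : ℝ => quatIter α Q n (x + (t : UnitAddCircle)) := by
      ext1 t
      rw [Function.comp_apply, ← toQuat_iter]
      exact congrFun (congrFun (toMat_toQuat _).symm i) j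
    rw [D, Matrix.of_apply, e, h1]
    rfl
  rw [logDerivAvg, hDer, ← toMat_star_toQuat, toQuat_iter, ← toMat_mul, mul_assoc,
    Quaternion.self_mul_star, Quaternion.normSq_eq_norm_mul_self, norm_quatIter hQ, ← toMat_smul]
  -- At `n = 0` both sides vanish, by the convention `0⁻¹ = 0`.
  rcases Nat.eq_zero_or_pos n with rfl | hn
  · simp [A, transferAvg]
  · rw [one_mul, Quaternion.coe_one, mul_one, ← Nat.cast_smul_eq_nsmul ℝ, smul_smul,
      inv_mul_cancel₀ (Nat.cast_ne_zero.2 hn.ne'), one_smul]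

end Bridge

end SU2Cocycle

end

/-! ### The main theorem -/

open SU2Cocycle

theorem theorem7p3 (α : ℝ) (hα_pos : 0 < α) (hα : α ^ 2 + α = 1)
    (φ : UnitAddCircle → SU2Cocycle.SU2) (hφ : SU2Cocycle.IsClassC 2 φ) :
    ∃ d : ℝ, SU2Cocycle.IsDegree (α : UnitAddCircle) φ d ∧
      ∃ k : ℕ, d = 2 * Real.pi * (k : ℝ) := by
  obtain ⟨hQc, Q', hQ'c, hD⟩ := exists_continuous_deriv_of_lift (Q := fun x => toQuat (φ x).1)
    (contDiff_toQuat hφ)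
  have hQ : ∀ x, ‖toQuat (φ x).1‖ = 1 := fun x => norm_toQuat _
  obtain ⟨ψ, d, hre, hψm, hψL, hinv, hlim, hae, hd⟩ := exists_transferAvg_limit
    (addOrderOf_golden hα_pos hα) hQc hQ (hQ'c.mul hQc.star) (re_mul_star_eq_zero hQ hD)
  refine ⟨d, ⟨fun x => toMat (ψ x), fun x => toMat_mem_su2 (hre x),
    fun i j => (toMatEntry i j).comp_memLp' hψL, ?_, ?_, ?_⟩, ?_⟩
  · have h : Tendsto (fun n => eLpNorm (transferAvg (· + (α : UnitAddCircle))
        (fun y => toQuat (φ y).1) n (fun y => Q' y * star (toQuat (φ y).1)) - ψ) 2 volume ^ 2)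
        atTop (𝓝 0) := by
      have h2 := ENNReal.Tendsto.pow (n := 2) hlim
      rwa [zero_pow two_ne_zero] at h2
    refine h.congr fun n => ?_
    have e := eLpNorm_nnreal_pow_eq_lintegral (μ := (volume : Measure UnitAddCircle))
      (f := transferAvg (· + (α : UnitAddCircle))
        (fun y => toQuat (φ y).1) n (fun y => Q' y * star (toQuat (φ y).1)) - ψ)
      (p := 2) two_ne_zero
    simp only [NNReal.coe_ofNat, ENNReal.rpow_ofNat, ENNReal.coe_ofNat] at e
    rw [e]
    refine lintegral_congr fun x => ?_
    rw [logDerivAvg_eq_toMat hD, ← toMat_sub, hsNorm_toMat, ENNReal.ofReal_pow (norm_nonneg _),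
      ofReal_norm, Pi.sub_apply]
  · filter_upwards [hae] with x hx
    simp only [logDerivAvg_eq_toMat hD]
    exact (continuous_toMat.tendsto _).comp hx
  · filter_upwards [hd] with x hx
    rw [hsNorm_toMat, hx]
  · obtain ⟨x, hx⟩ := hd.exists
    have hd0 : 0 ≤ d := hx ▸ norm_nonneg _
    -- The commutation argument needs `ψ ≠ 0`; for `d = 0` the multiple is `k = 0`.
    rcases hd0.eq_or_lt with h0 | hpos
    · exact ⟨0, by simp [← h0]⟩
    · obtain ⟨m, hm⟩ := (Real.cos_eq_one_iff d).1 (cos_norm_limit_eq_one hα_pos hα hQ hQc hQ'c hD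
        hpos hre hψm hψL hinv hlim hd)
      have hm0 : 0 ≤ m := by
        by_contra! hneg
        have : (m : ℝ) < 0 := by exact_mod_cast hneg
        nlinarith [Real.pi_pos]
      lift m to ℕ using hm0
      exact ⟨m, by rw [← hm, Int.cast_natCast]; ring⟩
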